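/- **Setting.** Consider a finite two-player extensive-form game with perfect recall and without chance moves; every inner node of the game tree belongs to one of the two players and has at least one action. Let $\mathcal I_i$ be the set of (nonempty) information sets of Player $i$, $A_I$ the set of actions at $I$, and $\Sigma_i=\{(I,a): I\in\mathcal I_i,\ a\in A_I\}\cup\{\varnothing\}$ the set of sequences of Player $i$. For $I\in\mathcal I_i$, the parent sequence $\sigma(I)$ is the last pair $(I',a')\in\Sigma_i$ on the path from the root to any node of $I$, or $\varnothing$ if there is none. Write $I_1\rightleftharpoons I_2$ if some node of one of $I_1\in\mathcal I_1$, $I_2\in\mathcal I_2$ lies on the path from the root to some node of the other. A pair $(\sigma_1,\sigma_2)\in\Sigma_1\times\Sigma_2$ is *relevant* if $\sigma_1=\varnothing$, or $\sigma_2=\varnothing$, or $\sigma_i=(I_i,a_i)$ with $I_1\rightleftharpoons I_2$. Likewise $(I_1,\sigma_2)$ is relevant if $\sigma_2=\varnothing$ or $\sigma_2=(I_2,a_2)$ with $I_1\rightleftharpoons I_2$, and symmetrically for $(\sigma_1,I_2)$. The polytope $\Xi$ of correlation plans is the set of all nonnegative vectors $\xi$ indexed by the relevant sequence pairs such that $\xi[\varnothing,\varnothing]=1$,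 $\sum_{a\in A_{I_1}}\xi[(I_1,a),\sigma_2]=\xi[\sigma(I_1),\sigma_2]$ for all relevant $(I_1,\sigma_2)$, and $\sum_{a\in A_{I_2}}\xi[\sigma_1,(I_2,a)]=\xi[\sigma_1,\sigma(I_2)]$ for all relevant $(\sigma_1,I_2)$. A *regret minimizer* for $\mathcal X\subseteq\mathbb R^n$ is a deterministic device that in each round $t$ recommends a decision $x^t\in\mathcal X$, depending only on the losses of the earlier rounds, and then observes a loss vector $\ell^t\in\mathbb R^n$. Its regret is $R^T=\sum_{t\le T}\langle\ell^t,x^t\rangle-\min_{\hat x\in\mathcal X}\sum_{t\le T}\langle\ell^t,\hat x\rangle$. It is *Hannan consistent* if for every $B$ there is $\rho$ with $\rho(T)/T\to0$ and $R^T\le\rho(T)$ for all $T$ and all loss sequences whose entries are bounded by $B$ in absolute value. It *runs in $n$ steps per iteration* if its two operations (recommend, observe loss) are realized by straight-line programs over real-valued registers, initially $0$, with $n$ instructions in total, each of them one of: load $0$ or $1$, copy, $+$, $-$, $\times$, $\div$, or selection between two registers according to the sign of a third. For a linear function $h(x)=\langle a,x\rangle$ that is nonnegative on $\mathcal X$,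 the *scaled extension* of $\mathcal X$ with $\mathcal Y$ via $h$ is $\{(x,h(x)y):x\in\mathcal X,\ y\in\mathcal Y\}$. Its *regret circuit* combines a regret minimizer for $\mathcal X$ and one for $\mathcal Y$: if they recommend $x^t$ and $y^t$, it recommends $(x^t,h(x^t)y^t)$; on the loss $(\ell_x^t,\ell_y^t)$ it gives the loss $\ell_y^t$ to the second and $\ell_x^t+\langle\ell_y^t,y^t\rangle a$ to the first. **Theorem.** There are regret minimizers $R_s$ for the simplices $\Delta^s$ ($s\ge1$) and a constant $C$ such that every $R_s$ is Hannan consistent and runs in at most $Cs$ steps per iteration, and such that for every finite two-player perfect-recall extensive-form game without chance moves there is a Hannan-consistent regret minimizer for $\Xi$ that runs in at most $C\cdot N$ steps per iteration, where $N$ is the number of relevant sequence pairs of the game. Moreover, it can be chosen as follows: up to the naming of coordinates, $\Xi$ is a chain of scaled extensions via nonnegative linear functions that starts from $\{1\}$ and extends in each step by a simplex $\Delta^s$ ($s\ge1$) or by the singleton $\{1\}$, and the regret minimizer is obtained by applying the regret circuit in each step of the chain, with a copy of $R_s$ on $\Delta^s$ and the constant decision on $\{1\}$. -/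

import Mathlib

/-! ## Finite two-player perfect-recall extensive-form games without chance moves

The players are the elements of `Fin 2`: `0` is Player 1 and `1` is Player 2. -/

/-- Game trees in which every inner node belongs to a player `i` and carries the label `I` of
the information set (of Player `i`) that contains the node; it has one child for every action
available at `I`. The leaves carry the payoffs. There are no chance nodes. -/
inductive GameTree (Info : Fin 2 → Type) (Act : (i : Fin 2) → Info i → Type) : Type
  | leaf (payoff : Fin 2 → ℝ) : GameTree Info Act
  | node (i : Fin 2) (I : Info i) (next : Act i I → GameTree Info Act) : GameTree Info Act

/-- A move: a player, one of the player's information sets, and an action available there. -/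
abbrev Move (Info : Fin 2 → Type) (Act : (i : Fin 2) → Info i → Type) : Type :=
  Σ i : Fin 2, Σ I : Info i, Act i I

/-- `Reaches t h t'`: the list of moves `h` is a path from the root of `t` to a node of `t`
whose subtree is `t'`. The nodes of a tree are identified with the paths that lead to them. -/
inductive Reaches {Info : Fin 2 → Type} {Act : (i : Fin 2) → Info i → Type} :
    GameTree Info Act → List (Move Info Act) → GameTree Info Act → Prop
  | nil (t : GameTree Info Act) : Reaches t [] t
  | cons {i : Fin 2} {I : Info i} {next : Act i I → GameTree Info Act} {a : Act i I}
      {h : List (Move Info Act)} {t : GameTree Info Act} :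
      Reaches (next a) h t → Reaches (GameTree.node i I next) (⟨i, I, a⟩ :: h) t

/-- The node of `t` at the end of the path `h` belongs to the information set `I`. -/
def NodeIn {Info : Fin 2 → Type} {Act : (i : Fin 2) → Info i → Type} (t : GameTree Info Act)
    {i : Fin 2} (h : List (Move Info Act)) (I : Info i) : Prop :=
  ∃ next : Act i I → GameTree Info Act, Reaches t h (GameTree.node i I next)

/-- The (information set, action) pairs of Player `i` along the path `h`, in order. -/
def movesOf {Info : Fin 2 → Type} {Act : (i : Fin 2) → Info i → Type} (i : Fin 2)
    (h : List (Move Info Act)) : List (Σ I : Info i, Act i I) :=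
  h.filterMap fun m => if e : m.1 = i then some (e ▸ m.2) else none

/-- A finite two-player extensive-form game with perfect recall and without chance moves. -/
structure Game where
  /-- the information sets of each player -/
  Info : Fin 2 → Type
  /-- the actions available at an information set -/
  Act : (i : Fin 2) → Info i → Type
  [fintypeInfo : ∀ i, Fintype (Info i)]
  [fintypeAct : ∀ i I, Fintype (Act i I)]
  [nonemptyAct : ∀ i I, Nonempty (Act i I)]
  /-- the game tree -/
  root : GameTree Info Act
  /-- information sets are nonempty sets of nodes -/
  exists_node : ∀ (i : Fin 2) (I : Info i), ∃ h, NodeIn root h I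
  /-- at any two nodes of one of their information sets, a player has the same record of the
  own information sets visited and of the own actions taken -/
  perfect_recall : ∀ (i : Fin 2) (I : Info i) (h h' : List (Move Info Act)),
    NodeIn root h I → NodeIn root h' I → movesOf i h = movesOf i h'

attribute [instance] Game.fintypeInfo Game.fintypeAct Game.nonemptyAct

namespace Game

/-- The sequences of Player `i`: the pairs `(I, a)` and the empty sequence `none`. -/
abbrev Seq (G : Game) (i : Fin 2) : Type := Option (Σ I : G.Info i, G.Act i I)

/-- The parent sequence `σ(I)`: the last pair `(I', a')` of the same player on the path from
the root to a node of `I` (to any of them, by perfect recall), or the empty sequence. -/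
noncomputable def parentSeq (G : Game) {i : Fin 2} (I : G.Info i) : G.Seq i :=
  (movesOf i (Classical.choose (G.exists_node i I))).getLast?

/-- Connected information sets `I ⇌ J`: some node of one is on the path from the root to some
node of the other. -/
def Connected (G : Game) (I : G.Info 0) (J : G.Info 1) : Prop :=
  ∃ u v : List (Move G.Info G.Act), NodeIn G.root u I ∧ NodeIn G.root v J ∧ (u <+: v ∨ v <+: u)

/-- Relevant sequence pairs: one of the two sequences is empty, or `σ₁ = (I, a)`, `σ₂ = (J, b)`
and `I ⇌ J`. (Membership in `Option`: `x ∈ σ` says that `σ` is `some x`.) -/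
def Relevant (G : Game) (σ₁ : G.Seq 0) (σ₂ : G.Seq 1) : Prop :=
  ∀ x ∈ σ₁, ∀ y ∈ σ₂, G.Connected x.1 y.1

/-- `I` and `σ₂` are relevant for each other: `σ₂` is empty or `σ₂ = (J, b)` with `I ⇌ J`. -/
def RelevantInfoSeq (G : Game) (I : G.Info 0) (σ₂ : G.Seq 1) : Prop :=
  ∀ y ∈ σ₂, G.Connected I y.1

/-- `σ₁` and `J` are relevant for each other: `σ₁` is empty or `σ₁ = (I, a)` with `I ⇌ J`. -/
def RelevantSeqInfo (G : Game) (σ₁ : G.Seq 0) (J : G.Info 1) : Prop :=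
  ∀ x ∈ σ₁, G.Connected x.1 J

/-- The index set of correlation plans. -/
abbrev RelevantPair (G : Game) : Type := {p : G.Seq 0 × G.Seq 1 // G.Relevant p.1 p.2}

noncomputable instance (G : Game) : Fintype G.RelevantPair := Fintype.ofFinite _

theorem relevant_empty (G : Game) : G.Relevant none none := by
  intro x hx
  simp at hx

theorem RelevantInfoSeq.child {G : Game} {I : G.Info 0} {σ₂ : G.Seq 1}
    (h : G.RelevantInfoSeq I σ₂) (a : G.Act 0 I) : G.Relevant (some ⟨I, a⟩) σ₂ := by
  intro x hx y hy
  obtain rfl := Option.some.inj hx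
  exact h y hy

theorem RelevantSeqInfo.child {G : Game} {σ₁ : G.Seq 0} {J : G.Info 1}
    (h : G.RelevantSeqInfo σ₁ J) (b : G.Act 1 J) : G.Relevant σ₁ (some ⟨J, b⟩) := by
  intro x hx y hy
  obtain rfl := Option.some.inj hy
  exact h x hx

end Game

theorem Reaches.nodeIn_of_mem_movesOf {Info : Fin 2 → Type} {Act : (i : Fin 2) → Info i → Type}
    {i : Fin 2} {x : Σ I : Info i, Act i I} {t t' : GameTree Info Act}
    {h : List (Move Info Act)} (r : Reaches t h t') (hx : x ∈ movesOf i h) :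
    ∃ u, u <+: h ∧ NodeIn t u x.1 := by
  induction r with
  | nil t => simp [movesOf] at hx
  | @cons j J next b h t r ih =>
    by_cases e : j = i ∧ x ∉ movesOf i h
    · obtain ⟨rfl, hn⟩ := e
      have : x = ⟨J, b⟩ := by
        simp only [movesOf, List.filterMap_cons, dite_true, List.mem_cons] at hx hn
        exact hx.resolve_right hn
      subst this
      exact ⟨[], List.nil_prefix, next, Reaches.nil _⟩
    · have hx' : x ∈ movesOf i h := by
        by_cases hj : j = i
        · by_contra hn
          exact e ⟨hj, hn⟩
        · simpa [movesOf, List.filterMap_cons, hj] using hx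
      obtain ⟨u, hu, next', r'⟩ := ih hx'
      exact ⟨⟨j, J, b⟩ :: u, (List.prefix_cons_inj _).2 hu, next', Reaches.cons r'⟩

namespace Game

theorem exists_prefix_of_mem_parentSeq (G : Game) {i : Fin 2} {I : G.Info i}
    {x : Σ I : G.Info i, G.Act i I} (hx : x ∈ G.parentSeq I) {u : List (Move G.Info G.Act)}
    (hu : NodeIn G.root u I) : ∃ w, w <+: u ∧ NodeIn G.root w x.1 := by
  have hc := Classical.choose_spec (G.exists_node i I)
  have hm : x ∈ movesOf i u := by
    rw [G.perfect_recall i I _ _ hu hc]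
    exact List.mem_of_getLast? hx
  obtain ⟨next, r⟩ := hu
  exact r.nodeIn_of_mem_movesOf hm

theorem RelevantInfoSeq.parent {G : Game} {I : G.Info 0} {σ₂ : G.Seq 1}
    (h : G.RelevantInfoSeq I σ₂) : G.Relevant (G.parentSeq I) σ₂ := by
  intro x hx y hy
  obtain ⟨u, v, hu, hv, huv⟩ := h y hy
  obtain ⟨w, hwu, hw⟩ := G.exists_prefix_of_mem_parentSeq hx hu
  refine ⟨w, v, hw, hv, ?_⟩
  rcases huv with huv | huv
  · exact Or.inl (hwu.trans huv)
  · exact List.prefix_or_prefix_of_prefix hwu huv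

theorem RelevantSeqInfo.parent {G : Game} {σ₁ : G.Seq 0} {J : G.Info 1}
    (h : G.RelevantSeqInfo σ₁ J) : G.Relevant σ₁ (G.parentSeq J) := by
  intro x hx y hy
  obtain ⟨u, v, hu, hv, huv⟩ := h x hx
  obtain ⟨w, hwv, hw⟩ := G.exists_prefix_of_mem_parentSeq hy hv
  refine ⟨u, w, hu, hw, ?_⟩
  rcases huv with huv | huv
  · exact List.prefix_or_prefix_of_prefix huv hwv
  · exact Or.inr (hwv.trans huv)

/-- The polytope `Ξ` of correlation plans. -/
def Xi (G : Game) : Set (G.RelevantPair → ℝ) :=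
  {ξ | (∀ p, 0 ≤ ξ p) ∧
    ξ ⟨(none, none), G.relevant_empty⟩ = 1 ∧
    (∀ (I : G.Info 0) (σ₂ : G.Seq 1) (h : G.RelevantInfoSeq I σ₂),
      ∑ a : G.Act 0 I, ξ ⟨(some ⟨I, a⟩, σ₂), h.child a⟩ = ξ ⟨(G.parentSeq I, σ₂), h.parent⟩) ∧
    (∀ (J : G.Info 1) (σ₁ : G.Seq 0) (h : G.RelevantSeqInfo σ₁ J),
      ∑ b : G.Act 1 J, ξ ⟨(σ₁, some ⟨J, b⟩), h.child b⟩ = ξ ⟨(σ₁, G.parentSeq J), h.parent⟩)}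

end Game

/-! ## Online decision makers and regret -/

/-- An online decision maker for linear losses on `ℝ^ι`: `recommend` gives the next decision,
`observe` updates the state with the loss vector that evaluates this decision. -/
structure OnlineAlgorithm (ι : Type) where
  State : Type
  init : State
  recommend : State → ι → ℝ
  observe : State → (ι → ℝ) → State

namespace OnlineAlgorithm

/-- The state after the losses `ℓ 0, …, ℓ (t - 1)`. -/
def stateAt {ι : Type} (A : OnlineAlgorithm ι) (ℓ : ℕ → ι → ℝ) : ℕ → A.State
  | 0 => A.init
  | t + 1 => A.observe (A.stateAt ℓ t) (ℓ t)

/-- The decision that is evaluated by the loss `ℓ t`; it depends on `ℓ 0, …, ℓ (t - 1)` only. -/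
def decision {ι : Type} (A : OnlineAlgorithm ι) (ℓ : ℕ → ι → ℝ) (t : ℕ) : ι → ℝ :=
  A.recommend (A.stateAt ℓ t)

/-- All decisions are in `X`, whatever the losses are. -/
def IsRegretMinimizer {ι : Type} (A : OnlineAlgorithm ι) (X : Set (ι → ℝ)) : Prop :=
  ∀ (ℓ : ℕ → ι → ℝ) (t : ℕ), A.decision ℓ t ∈ X

/-- The cumulative regret after `T` rounds; the infimum is a minimum when `X` is nonempty and
compact. -/
noncomputable def cumRegret {ι : Type} [Fintype ι] (A : OnlineAlgorithm ι) (X : Set (ι → ℝ))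
    (ℓ : ℕ → ι → ℝ) (T : ℕ) : ℝ :=
  (∑ t ∈ Finset.range T, ∑ i, ℓ t i * A.decision ℓ t i) -
    sInf ((fun x : ι → ℝ => ∑ t ∈ Finset.range T, ∑ i, ℓ t i * x i) '' X)

/-- Hannan consistency: for bounded losses, the worst-case cumulative regret is sublinear. -/
def HannanConsistent {ι : Type} [Fintype ι] (A : OnlineAlgorithm ι) (X : Set (ι → ℝ)) : Prop :=
  ∀ B : ℝ, ∃ ρ : ℕ → ℝ,
    Filter.Tendsto (fun T : ℕ => ρ T / (T : ℝ)) Filter.atTop (nhds 0) ∧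
    ∀ ℓ : ℕ → ι → ℝ, (∀ t i, |ℓ t i| ≤ B) → ∀ T : ℕ, A.cumRegret X ℓ T ≤ ρ T

end OnlineAlgorithm

/-! ## Running time: straight-line programs over the reals, one step per instruction -/

/-- The memory: one real number in each register. -/
abbrev Memory : Type := ℕ → ℝ

/-- The instructions; the first argument is the register that receives the result. -/
inductive Instr : Type
  | zero (d : ℕ) : Instr
  | one (d : ℕ) : Instr
  | copy (d a : ℕ) : Instr
  | add (d a b : ℕ) : Instr
  | sub (d a b : ℕ) : Instr
  | mul (d a b : ℕ) : Instr
  | div (d a b : ℕ) : Instr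
  /-- the content of `a` if that of `c` is positive, the content of `b` otherwise -/
  | select (d c a b : ℕ) : Instr

/-- The effect of one instruction on the memory. -/
noncomputable def Instr.exec : Instr → Memory → Memory
  | zero d, m => Function.update m d 0
  | one d, m => Function.update m d 1
  | copy d a, m => Function.update m d (m a)
  | add d a b, m => Function.update m d (m a + m b)
  | sub d a b, m => Function.update m d (m a - m b)
  | mul d a b, m => Function.update m d (m a * m b)
  | div d a b, m => Function.update m d (m a / m b)
  | select d c a b, m => Function.update m d (open Classical in if 0 < m c then m a else m b)

/-- The effect of a list of instructions, executed in order. -/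
noncomputable def execList (p : List Instr) (m : Memory) : Memory :=
  p.foldl (fun m q => q.exec m) m

/-- An implementation of the two operations of an online decision maker on `ℝ^ι` by
straight-line programs. Coordinate `i` of a decision or of a loss is exchanged through the
register `port i`. -/
structure Program (ι : Type) where
  port : ι ↪ ℕ
  recommend : List Instr
  observe : List Instr

/-- The number of steps of one iteration: one call of each of the two operations. -/
def Program.steps {ι : Type} (P : Program ι) : ℕ := P.recommend.length + P.observe.length

/-- The online decision maker that a program realizes. All registers are `0` at the start. In
each round the recommendation program is run and the decision is read at the ports; then the
loss is written to the ports and the observation program is run. The memory persists. -/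
noncomputable def Program.toAlgorithm {ι : Type} (P : Program ι) : OnlineAlgorithm ι where
  State := Memory
  init := fun _ => 0
  recommend m i := execList P.recommend m (P.port i)
  observe m ℓ := execList P.observe (Function.extend P.port ℓ (execList P.recommend m))

/-- `A` runs in at most `n` steps per iteration: some program with at most `n` steps per
iteration makes the same decisions as `A` on all sequences of losses. -/
def OnlineAlgorithm.RunsInTime {ι : Type} (A : OnlineAlgorithm ι) (n : ℕ) : Prop :=
  ∃ P : Program ι, P.steps ≤ n ∧ ∀ (ℓ : ℕ → ι → ℝ) (t : ℕ),
    P.toAlgorithm.decision ℓ t = A.decision ℓ t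

/-! ## Scaled extensions and their regret circuit -/

/-- The scaled extension of `X` with `Y` via `h`: all `(x, h(x) y)` with `x ∈ X`, `y ∈ Y`. -/
def scaledExtension {α β : Type} (X : Set (α → ℝ)) (h : (α → ℝ) → ℝ) (Y : Set (β → ℝ)) :
    Set (α ⊕ β → ℝ) :=
  {z | ∃ x ∈ X, ∃ y ∈ Y, z = Sum.elim x (h x • y)}

namespace OnlineAlgorithm

/-- The regret circuit for the scaled extension via the linear function `h(x) = ⟨a, x⟩`. From
the decisions `x` of `A` and `y` of `B` it forms `(x, h(x) y)`; of a loss `(ℓ_x, ℓ_y)` it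
forwards `ℓ_y` to `B` and `ℓ_x + ⟨ℓ_y, y⟩ a` to `A`. -/
def scaledExt {α β : Type} [Fintype α] [Fintype β] (A : OnlineAlgorithm α) (a : α → ℝ)
    (B : OnlineAlgorithm β) : OnlineAlgorithm (α ⊕ β) where
  State := A.State × B.State
  init := (A.init, B.init)
  recommend s := Sum.elim (A.recommend s.1)
    ((∑ i, a i * A.recommend s.1 i) • B.recommend s.2)
  observe s ℓ :=
    (A.observe s.1 (fun i => ℓ (Sum.inl i) + (∑ j, ℓ (Sum.inr j) * B.recommend s.2 j) * a i),
      B.observe s.2 (fun j => ℓ (Sum.inr j)))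

/-- The online decision maker on `ℝ` that always decides for `1`. -/
def alwaysOne : OnlineAlgorithm Unit where
  State := Unit
  init := ()
  recommend _ _ := 1
  observe _ _ := ()

/-- Renaming of the coordinates. -/
def reindex {α β : Type} (e : α ≃ β) (A : OnlineAlgorithm α) : OnlineAlgorithm β where
  State := A.State
  init := A.init
  recommend s j := A.recommend s (e.symm j)
  observe s ℓ := A.observe s (fun i => ℓ (e i))

end OnlineAlgorithm

/-- `ScaledExtensionCircuit R X A`: up to names of coordinates, `X` is a chain of scaled
extensions, via nonnegative linear functions, that starts from `{1}` and in each step extends by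
a simplex `Δ^s` (`s ≥ 1`) or by the singleton `{1}`, and `A` is the online decision maker
obtained by applying the regret circuit for scaled extensions in each step, with the local
decision maker `R s` on `Δ^s` and the constant one on `{1}`. -/
inductive ScaledExtensionCircuit (R : (s : ℕ) → OnlineAlgorithm (Fin s)) :
    {α : Type} → [Fintype α] → Set (α → ℝ) → OnlineAlgorithm α → Prop
  | base : ScaledExtensionCircuit R {(fun _ => 1 : Unit → ℝ)} OnlineAlgorithm.alwaysOne
  | simplex {α : Type} [Fintype α] {X : Set (α → ℝ)} {A : OnlineAlgorithm α} (a : α → ℝ)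
      (s : ℕ) : ScaledExtensionCircuit R X A → (∀ x ∈ X, 0 ≤ ∑ i, a i * x i) → 1 ≤ s →
      ScaledExtensionCircuit R
        (scaledExtension X (fun x => ∑ i, a i * x i) (stdSimplex ℝ (Fin s)))
        (A.scaledExt a (R s))
  | singleton {α : Type} [Fintype α] {X : Set (α → ℝ)} {A : OnlineAlgorithm α} (a : α → ℝ) :
      ScaledExtensionCircuit R X A → (∀ x ∈ X, 0 ≤ ∑ i, a i * x i) →
      ScaledExtensionCircuit R
        (scaledExtension X (fun x => ∑ i, a i * x i) {(fun _ => 1 : Unit → ℝ)})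
        (A.scaledExt a OnlineAlgorithm.alwaysOne)
  | rename {α β : Type} [Fintype α] [Fintype β] {X : Set (α → ℝ)} {A : OnlineAlgorithm α}
      (e : α ≃ β) : ScaledExtensionCircuit R X A →
      ScaledExtensionCircuit R {x : β → ℝ | (fun i => x (e i)) ∈ X} (A.reindex e)

/-! The regret of the circuit for a scaled extension splits: against `(x, h(x) y)` it is the regret
of the first device against `x` plus `h(x)` times the regret of the second against `y`
(`regret_scaledExt`). As `h` is nonnegative and bounded on a bounded set, Hannan consistency passes
along every chain of scaled extensions. On the simplices, regret matching serves: its squared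
positive regrets sum to `O(T)`, and it needs `O(s)` instructions per round.

It remains to write Ξ as such a chain. Without chance moves, the plans of both players determine a
single path (`Reaches.prefix_or_prefix`). With perfect recall it follows that two information sets
of different players cannot both precede each other (`Before.asymm`), and that at most one
information set with a given parent sequence precedes a given information set of the opponent
(`Before.eq_of_parentSeq_eq`). Hence every relevant pair other than the root has exactly one way to
be filled in. Either it arises forward, when the value of a pair is distributed over the actions at
an information set, or it is computed backward, as the sum of its extensions at an information set
that precedes the last one of the opponent. The function `pairRank` decreases from a pair to those
it is computed from, so the process is acyclic. Each block is a scaled extension by a simplex (by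
`Δ^1` if backward), with `h` a sum of known coordinates.

The blocks use only some of the equations of Ξ. The others follow by exchanging sums
(`sum_extend_of_mem_polytope`), which gives `Xi_eq`.

One step of the chain costs time linear in the size of its block and in the number of summands of
`h`. A forward block has one summand, and every pair is a summand of at most one backward block, so
the total is linear in the number of relevant pairs (`sum_card_sources_le`). -/

/-! ## Regret of the circuits -/

namespace OnlineAlgorithm

/-- All coordinates of all points of `X` are bounded by one constant. -/
def CoordBounded {ι : Type} (X : Set (ι → ℝ)) : Prop :=
  ∃ M : ℝ, ∀ x ∈ X, ∀ i, |x i| ≤ M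

theorem cumRegret_le {ι : Type} [Fintype ι] {A : OnlineAlgorithm ι} {X : Set (ι → ℝ)}
    (hX : X.Nonempty) {ℓ : ℕ → ι → ℝ} {T : ℕ} {c : ℝ}
    (h : ∀ x ∈ X, ∑ t ∈ Finset.range T, ∑ i, ℓ t i * (A.decision ℓ t i - x i) ≤ c) :
    A.cumRegret X ℓ T ≤ c := by
  rw [cumRegret, sub_le_comm]
  refine le_csInf (hX.image _) ?_
  rintro _ ⟨x, hx, rfl⟩
  have := h x hx
  simp only [mul_sub, Finset.sum_sub_distrib] at this
  simp only
  linarith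

/-- Boundedness of `X` makes the infimum genuine: `sInf` of a set that is unbounded below is `0`. -/
theorem le_cumRegret {ι : Type} [Fintype ι] (A : OnlineAlgorithm ι) {X : Set (ι → ℝ)}
    (hX : CoordBounded X) (ℓ : ℕ → ι → ℝ) (T : ℕ) {x : ι → ℝ} (hx : x ∈ X) :
    ∑ t ∈ Finset.range T, ∑ i, ℓ t i * (A.decision ℓ t i - x i) ≤ A.cumRegret X ℓ T := by
  obtain ⟨M, hM⟩ := hX
  have hb : BddBelow ((fun x : ι → ℝ => ∑ t ∈ Finset.range T, ∑ i, ℓ t i * x i) '' X) := by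
    refine ⟨∑ t ∈ Finset.range T, ∑ i, -(|ℓ t i| * M), ?_⟩
    rintro _ ⟨x, hx, rfl⟩
    refine Finset.sum_le_sum fun t _ => Finset.sum_le_sum fun i _ => ?_
    have h1 : |ℓ t i * x i| ≤ |ℓ t i| * M := by
      rw [abs_mul]
      exact mul_le_mul_of_nonneg_left (hM x hx i) (abs_nonneg _)
    exact (abs_le.1 h1).1
  have := csInf_le hb ⟨x, hx, rfl⟩
  simp only [cumRegret, mul_sub, Finset.sum_sub_distrib]
  simp only at this
  linarith

/-- The losses that the regret circuit for scaled extensions forwards to the second device. -/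
def lossRight {α β : Type} (ℓ : ℕ → α ⊕ β → ℝ) : ℕ → β → ℝ :=
  fun t j => ℓ t (Sum.inr j)

/-- The losses that the regret circuit for scaled extensions forwards to the first device. -/
def lossLeft {α β : Type} [Fintype β] (a : α → ℝ) (B : OnlineAlgorithm β)
    (ℓ : ℕ → α ⊕ β → ℝ) : ℕ → α → ℝ :=
  fun t i => ℓ t (Sum.inl i) + (∑ j, ℓ t (Sum.inr j) * B.decision (lossRight ℓ) t j) * a i

/-- The two devices decouple: each runs on its own loss sequence, and the second one does not depend
on the first. -/
theorem stateAt_scaledExt {α β : Type} [Fintype α] [Fintype β] (A : OnlineAlgorithm α)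
    (a : α → ℝ) (B : OnlineAlgorithm β) (ℓ : ℕ → α ⊕ β → ℝ) (t : ℕ) :
    (A.scaledExt a B).stateAt ℓ t =
      (A.stateAt (lossLeft a B ℓ) t, B.stateAt (lossRight ℓ) t) := by
  induction t with
  | zero => rfl
  | succ t ih =>
    simp only [stateAt, ih]
    rfl

theorem decision_scaledExt {α β : Type} [Fintype α] [Fintype β] (A : OnlineAlgorithm α)
    (a : α → ℝ) (B : OnlineAlgorithm β) (ℓ : ℕ → α ⊕ β → ℝ) (t : ℕ) :
    (A.scaledExt a B).decision ℓ t =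
      Sum.elim (A.decision (lossLeft a B ℓ) t)
        ((∑ i, a i * A.decision (lossLeft a B ℓ) t i) • B.decision (lossRight ℓ) t) := by
  rw [decision, stateAt_scaledExt]
  rfl

theorem stateAt_reindex {α β : Type} (e : α ≃ β) (A : OnlineAlgorithm α) (ℓ : ℕ → β → ℝ)
    (t : ℕ) : (A.reindex e).stateAt ℓ t = A.stateAt (fun t i => ℓ t (e i)) t := by
  induction t with
  | zero => rfl
  | succ t ih =>
    simp only [stateAt, ih]
    rfl

theorem decision_reindex {α β : Type} (e : α ≃ β) (A : OnlineAlgorithm α) (ℓ : ℕ → β → ℝ)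
    (t : ℕ) (j : β) :
    (A.reindex e).decision ℓ t j = A.decision (fun t i => ℓ t (e i)) t (e.symm j) := by
  rw [decision, stateAt_reindex]
  rfl

theorem IsRegretMinimizer.scaledExt {α β : Type} [Fintype α] [Fintype β]
    {A : OnlineAlgorithm α} {B : OnlineAlgorithm β} {X : Set (α → ℝ)} {Y : Set (β → ℝ)}
    (hA : A.IsRegretMinimizer X) (hB : B.IsRegretMinimizer Y) (a : α → ℝ) :
    (A.scaledExt a B).IsRegretMinimizer (scaledExtension X (fun x => ∑ i, a i * x i) Y) := by
  intro ℓ t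
  rw [decision_scaledExt]
  exact ⟨_, hA _ t, _, hB _ t, rfl⟩

theorem CoordBounded.scaledExtension {α β : Type} [Fintype α] {X : Set (α → ℝ)}
    {Y : Set (β → ℝ)} (hX : CoordBounded X) (hY : CoordBounded Y) (a : α → ℝ) :
    CoordBounded (scaledExtension X (fun x => ∑ i, a i * x i) Y) := by
  obtain ⟨M, hM⟩ := hX
  obtain ⟨N, hN⟩ := hY
  refine ⟨max M ((∑ i, |a i| * M) * N), ?_⟩
  rintro _ ⟨x, hx, y, hy, rfl⟩ (i | j)
  · exact (hM x hx i).trans (le_max_left _ _)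
  · refine le_trans ?_ (le_max_right _ _)
    simp only [Sum.elim_inr, Pi.smul_apply, smul_eq_mul, abs_mul]
    have h1 : |∑ i, a i * x i| ≤ ∑ i, |a i| * M :=
      (Finset.abs_sum_le_sum_abs _ _).trans <| Finset.sum_le_sum fun i _ => by
        rw [abs_mul]
        exact mul_le_mul_of_nonneg_left (hM x hx i) (abs_nonneg _)
    exact mul_le_mul h1 (hN y hy j) (abs_nonneg _) ((abs_nonneg _).trans h1)

/-- With `h(x) = ⟨a, x⟩`, one round of the second component gives `⟨ℓ_y, h(xᵗ) yᵗ - h(x) y⟩ = (h(xᵗ)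
- h(x)) ⟨ℓ_y, yᵗ⟩ + h(x) ⟨ℓ_y, yᵗ - y⟩`. The first summand is linear in `xᵗ - x` and is exactly what
`lossLeft` adds to the loss of the first device. -/
theorem regret_scaledExt {α β : Type} [Fintype α] [Fintype β] (A : OnlineAlgorithm α)
    (a : α → ℝ) (B : OnlineAlgorithm β) (ℓ : ℕ → α ⊕ β → ℝ) (T : ℕ) (x : α → ℝ) (y : β → ℝ) :
    ∑ t ∈ Finset.range T, ∑ k, ℓ t k * ((A.scaledExt a B).decision ℓ t k -
        (Sum.elim x ((∑ i, a i * x i) • y) : α ⊕ β → ℝ) k) =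
      (∑ t ∈ Finset.range T, ∑ i, lossLeft a B ℓ t i *
        (A.decision (lossLeft a B ℓ) t i - x i)) +
      (∑ i, a i * x i) * ∑ t ∈ Finset.range T, ∑ j, lossRight ℓ t j *
        (B.decision (lossRight ℓ) t j - y j) := by
  rw [Finset.mul_sum, ← Finset.sum_add_distrib]
  refine Finset.sum_congr rfl fun t _ => ?_
  rw [decision_scaledExt, Fintype.sum_sum_type]
  simp only [Sum.elim_inl, Sum.elim_inr, Pi.smul_apply, smul_eq_mul]
  generalize hu : A.decision (lossLeft a B ℓ) t = u
  have h1 : ∀ i, lossLeft a B ℓ t i * (u i - x i) = ℓ t (Sum.inl i) * (u i - x i) +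
      (∑ j, ℓ t (Sum.inr j) * B.decision (lossRight ℓ) t j) * (a i * u i - a i * x i) := by
    intro i
    simp only [lossLeft]
    ring
  simp only [h1, Finset.sum_add_distrib, ← Finset.mul_sum, Finset.sum_sub_distrib, mul_sub]
  have h2 : ∀ (c : ℝ) (w : β → ℝ), ∑ j, ℓ t (Sum.inr j) * (c * w j) =
      c * ∑ j, ℓ t (Sum.inr j) * w j := by
    intro c w
    rw [Finset.mul_sum]
    exact Finset.sum_congr rfl fun j _ => by ring
  simp only [h2, lossRight]
  ring

theorem HannanConsistent.scaledExt {α β : Type} [Fintype α] [Fintype β]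
    {A : OnlineAlgorithm α} {B : OnlineAlgorithm β} {X : Set (α → ℝ)} {Y : Set (β → ℝ)}
    (hA : A.HannanConsistent X) (hB : B.HannanConsistent Y) (hYB : B.IsRegretMinimizer Y)
    (hX : X.Nonempty) (hY : Y.Nonempty) (bX : CoordBounded X) (bY : CoordBounded Y)
    (a : α → ℝ) (ha : ∀ x ∈ X, 0 ≤ ∑ i, a i * x i) :
    (A.scaledExt a B).HannanConsistent (scaledExtension X (fun x => ∑ i, a i * x i) Y) := by
  intro b
  obtain ⟨M, hM⟩ := id bX
  obtain ⟨N, hN⟩ := id bY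
  obtain ⟨ρB, hρB, hB⟩ := hB b
  -- The first device sees larger losses: `⟨ℓ_y, y⟩` is at most `card β * (|b| * N)`, and it
  -- multiplies an entry of `a`.
  obtain ⟨ρA, hρA, hA⟩ := hA (b + (Fintype.card β * (|b| * N)) * ∑ i, |a i|)
  set H : ℝ := ∑ i, |a i| * M with hH
  have hHx : ∀ x ∈ X, ∑ i, a i * x i ≤ H := fun x hx =>
    Finset.sum_le_sum fun i _ => (le_abs_self _).trans <| by
      rw [abs_mul]
      exact mul_le_mul_of_nonneg_left (hM x hx i) (abs_nonneg _)
  have hH0 : 0 ≤ H := (ha _ hX.some_mem).trans (hHx _ hX.some_mem)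
  -- The factor `h(x)` lies anywhere in `[0, H]`, so a negative `ρB T` must be replaced by `0`
  -- before `h(x)` is bounded by `H`.
  refine ⟨fun T => ρA T + H * max (ρB T) 0, ?_, ?_⟩
  · have h1 : Filter.Tendsto (fun T : ℕ => ρA T / (T : ℝ) + H * max (ρB T / (T : ℝ)) 0)
        Filter.atTop (nhds (0 + H * max 0 0)) :=
      hρA.add ((hρB.max tendsto_const_nhds).const_mul H)
    simp only [max_self, mul_zero, add_zero] at h1
    refine h1.congr fun T => ?_
    have : max (ρB T / (T : ℝ)) 0 = max (ρB T) 0 / (T : ℝ) := by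
      rw [← max_div_div_right (Nat.cast_nonneg T), zero_div]
    rw [this]
    ring
  · intro ℓ hℓ T
    have hbR : ∀ t j, |lossRight ℓ t j| ≤ b := fun t j => hℓ t _
    have hbL : ∀ t i, |lossLeft a B ℓ t i| ≤
        b + (Fintype.card β * (|b| * N)) * ∑ i, |a i| := by
      intro t i
      refine (abs_add_le _ _).trans (add_le_add (hℓ t _) ?_)
      rw [abs_mul]
      have h2 : |∑ j, ℓ t (Sum.inr j) * B.decision (lossRight ℓ) t j| ≤
          Fintype.card β * (|b| * N) := by
        refine (Finset.abs_sum_le_sum_abs _ _).trans ?_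
        rw [← nsmul_eq_mul, ← Finset.card_univ]
        refine Finset.sum_le_card_nsmul _ _ _ fun j _ => ?_
        rw [abs_mul]
        exact mul_le_mul ((hℓ t _).trans (le_abs_self b)) (hN _ (hYB _ t) j) (abs_nonneg _)
          (abs_nonneg _)
      refine mul_le_mul h2 ?_ (abs_nonneg _) ((abs_nonneg _).trans h2)
      exact Finset.single_le_sum (f := fun i => |a i|) (fun i _ => abs_nonneg _)
        (Finset.mem_univ i)
    refine cumRegret_le ?_ ?_
    · exact ⟨_, _, hX.some_mem, _, hY.some_mem, rfl⟩
    · rintro _ ⟨x, hx, y, hy, rfl⟩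
      rw [regret_scaledExt]
      refine add_le_add ((le_cumRegret A bX _ T hx).trans (hA _ hbL T)) ?_
      have h3 := (le_cumRegret B bY _ T hy).trans (hB _ hbR T)
      calc _ ≤ (∑ i, a i * x i) * max (ρB T) 0 :=
            mul_le_mul_of_nonneg_left (h3.trans (le_max_left _ _)) (ha x hx)
        _ ≤ _ := mul_le_mul_of_nonneg_right (hHx x hx) (le_max_right _ _)

theorem hannanConsistent_alwaysOne :
    alwaysOne.HannanConsistent {(fun _ => 1 : Unit → ℝ)} := by
  intro b
  refine ⟨fun _ => 0, by simp, fun ℓ _ T => ?_⟩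
  refine cumRegret_le (Set.singleton_nonempty _) ?_
  rintro _ rfl
  simp [decision, alwaysOne]

theorem HannanConsistent.reindex {α β : Type} [Fintype α] [Fintype β] {A : OnlineAlgorithm α}
    {X : Set (α → ℝ)} (hA : A.HannanConsistent X) (hX : X.Nonempty) (bX : CoordBounded X)
    (e : α ≃ β) :
    (A.reindex e).HannanConsistent {x : β → ℝ | (fun i => x (e i)) ∈ X} := by
  intro b
  obtain ⟨ρ, hρ, hA⟩ := hA b
  refine ⟨ρ, hρ, fun ℓ hℓ T => ?_⟩
  refine cumRegret_le ⟨fun j => hX.some (e.symm j), by simpa using hX.some_mem⟩ ?_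
  intro x hx
  refine Eq.trans_le ?_
    ((le_cumRegret A bX _ T hx).trans (hA (fun t i => ℓ t (e i)) (fun t i => hℓ t _) T))
  refine Finset.sum_congr rfl fun t _ => ?_
  rw [← Equiv.sum_comp e (fun j => ℓ t j * ((A.reindex e).decision ℓ t j - x j))]
  simp only [decision_reindex, Equiv.symm_apply_apply]

theorem coordBounded_stdSimplex (s : ℕ) : CoordBounded (stdSimplex ℝ (Fin s)) := by
  refine ⟨1, fun x hx i => ?_⟩
  rw [abs_of_nonneg (hx.1 i)]
  exact (Finset.single_le_sum (fun j _ => hx.1 j) (Finset.mem_univ i)).trans hx.2.le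

theorem stdSimplex_fin_nonempty {s : ℕ} (hs : 1 ≤ s) : (stdSimplex ℝ (Fin s)).Nonempty :=
  ⟨_, single_mem_stdSimplex ℝ (⟨0, hs⟩ : Fin s)⟩

end OnlineAlgorithm

open OnlineAlgorithm in
/-- Every circuit of scaled extensions that is built from good local decision makers is a
Hannan-consistent regret minimizer for the nonempty bounded set that belongs to it. -/
theorem ScaledExtensionCircuit.isRegretMinimizer_and_hannanConsistent
    {R : (s : ℕ) → OnlineAlgorithm (Fin s)}
    (hR : ∀ s : ℕ, 1 ≤ s → (R s).IsRegretMinimizer (stdSimplex ℝ (Fin s)) ∧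
      (R s).HannanConsistent (stdSimplex ℝ (Fin s)))
    {α : Type} [Fintype α] {X : Set (α → ℝ)} {A : OnlineAlgorithm α}
    (h : ScaledExtensionCircuit R X A) :
    X.Nonempty ∧ CoordBounded X ∧ A.IsRegretMinimizer X ∧ A.HannanConsistent X := by
  have h1 : alwaysOne.IsRegretMinimizer {(fun _ => 1 : Unit → ℝ)} := fun ℓ t => rfl
  have h2 : CoordBounded {(fun _ => 1 : Unit → ℝ)} := ⟨1, by rintro _ rfl i; simp⟩
  have h3 : ({(fun _ => 1 : Unit → ℝ)} : Set (Unit → ℝ)).Nonempty := ⟨_, rfl⟩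
  induction h with
  | base => exact ⟨h3, h2, h1, hannanConsistent_alwaysOne⟩
  | simplex a s _ ha hs ih =>
    obtain ⟨i1, i2, i3, i4⟩ := ih
    have n := stdSimplex_fin_nonempty hs
    have b := coordBounded_stdSimplex s
    exact ⟨⟨_, _, i1.some_mem, _, n.some_mem, rfl⟩, i2.scaledExtension b a,
      i3.scaledExt (hR s hs).1 a,
      i4.scaledExt (hR s hs).2 (hR s hs).1 i1 n i2 b a ha⟩
  | singleton a _ ha ih =>
    obtain ⟨i1, i2, i3, i4⟩ := ih
    exact ⟨⟨_, _, i1.some_mem, _, rfl, rfl⟩, i2.scaledExtension h2 a, i3.scaledExt h1 a,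
      i4.scaledExt hannanConsistent_alwaysOne h1 i1 h3 i2 h2 a ha⟩
  | rename e _ ih =>
    obtain ⟨i1, i2, i3, i4⟩ := ih
    refine ⟨⟨fun j => i1.some (e.symm j), by simpa using i1.some_mem⟩, ?_, ?_,
      i4.reindex i1 i2 e⟩
    · obtain ⟨M, hM⟩ := i2
      exact ⟨M, fun x hx j => by simpa using hM _ hx (e.symm j)⟩
    · intro ℓ t
      simpa only [Set.mem_ofPred_eq, decision_reindex, Equiv.symm_apply_apply] using i3 _ t

/-! ## Regret matching -/

namespace OnlineAlgorithm

/-- The unnormalized regret-matching weights: the positive parts of the regrets `r`, or `1`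
everywhere if no regret is positive. -/
noncomputable def matchingWeight {s : ℕ} (r : Fin s → ℝ) (j : Fin s) : ℝ :=
  open Classical in if 0 < ∑ k, max (r k) 0 then max (r j) 0 else 1

/-- Regret matching on the simplex `Δ^s`: the state is the vector of regrets with respect to
the vertices, and the decision is proportional to its positive part. -/
noncomputable def regretMatching (s : ℕ) : OnlineAlgorithm (Fin s) where
  State := Fin s → ℝ
  init := fun _ => 0
  recommend r j := matchingWeight r j / ∑ k, matchingWeight r k
  observe r ℓ := fun j =>
    r j + (∑ k, ℓ k * (matchingWeight r k / ∑ k, matchingWeight r k) - ℓ j)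

theorem matchingWeight_nonneg {s : ℕ} (r : Fin s → ℝ) (j : Fin s) : 0 ≤ matchingWeight r j := by
  unfold matchingWeight
  split_ifs
  · exact le_max_right _ _
  · exact zero_le_one

theorem sum_matchingWeight_pos {s : ℕ} (hs : 1 ≤ s) (r : Fin s → ℝ) :
    0 < ∑ k, matchingWeight r k := by
  unfold matchingWeight
  split_ifs with h
  · exact h
  · simpa using Nat.lt_of_lt_of_le Nat.zero_lt_one hs

theorem regretMatching_recommend_mem {s : ℕ} (hs : 1 ≤ s) (r : Fin s → ℝ) :
    (regretMatching s).recommend r ∈ stdSimplex ℝ (Fin s) := by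
  have h := sum_matchingWeight_pos hs r
  refine ⟨fun j => div_nonneg (matchingWeight_nonneg r j) h.le, ?_⟩
  simp only [regretMatching]
  rw [← Finset.sum_div, div_self h.ne']

theorem isRegretMinimizer_regretMatching {s : ℕ} (hs : 1 ≤ s) :
    (regretMatching s).IsRegretMinimizer (stdSimplex ℝ (Fin s)) :=
  fun _ _ => regretMatching_recommend_mem hs _

/-- Blackwell's condition: the decision is proportional to the positive regrets, which makes the new
regrets orthogonal to them. If no regret is positive, the positive parts vanish and any decision
would do. -/
theorem sum_max_mul_matching {s : ℕ} (r ℓ : Fin s → ℝ) :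
    ∑ j, max (r j) 0 * (∑ k, ℓ k * (regretMatching s).recommend r k - ℓ j) = 0 := by
  by_cases h : 0 < ∑ k, max (r k) 0
  · have hw : ∀ j, matchingWeight r j = max (r j) 0 := fun j => by simp [matchingWeight, h]
    simp only [regretMatching, hw, mul_sub, Finset.sum_sub_distrib, ← Finset.sum_mul]
    have h1 : ∑ k, ℓ k * (max (r k) 0 / ∑ k, max (r k) 0) =
        (∑ k, ℓ k * max (r k) 0) / ∑ k, max (r k) 0 := by
      rw [Finset.sum_div]
      exact Finset.sum_congr rfl fun k _ => by ring
    rw [h1, mul_div_cancel₀ _ h.ne', sub_eq_zero]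
    exact Finset.sum_congr rfl fun k _ => mul_comm _ _
  · have h0 : ∑ k, max (r k) 0 = 0 :=
      le_antisymm (not_lt.1 h) (Finset.sum_nonneg fun k _ => le_max_right _ _)
    rw [Finset.sum_eq_zero_iff_of_nonneg fun k _ => le_max_right _ _] at h0
    exact Finset.sum_eq_zero fun j hj => by rw [h0 j hj, zero_mul]

theorem sq_max_add_le (r d : ℝ) : max (r + d) 0 ^ 2 ≤ max r 0 ^ 2 + 2 * (max r 0 * d) + d ^ 2 := by
  have h : max (r + d) 0 ^ 2 ≤ (max r 0 + d) ^ 2 := by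
    rcases le_total (r + d) 0 with h1 | h1
    · rw [max_eq_right h1, zero_pow two_ne_zero]
      exact sq_nonneg _
    · rw [max_eq_left h1]
      exact pow_le_pow_left₀ h1 (by linarith [le_max_left r 0]) 2
  nlinarith

theorem abs_sum_mul_le_of_mem_stdSimplex {s : ℕ} {ℓ x : Fin s → ℝ} {b : ℝ}
    (hℓ : ∀ i, |ℓ i| ≤ b) (hx : x ∈ stdSimplex ℝ (Fin s)) : |∑ k, ℓ k * x k| ≤ b := by
  calc |∑ k, ℓ k * x k| ≤ ∑ k, b * x k :=
        (Finset.abs_sum_le_sum_abs _ _).trans <| Finset.sum_le_sum fun k _ => by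
          rw [abs_mul, abs_of_nonneg (hx.1 k)]
          exact mul_le_mul_of_nonneg_right (hℓ k) (hx.1 k)
    _ = b := by rw [← Finset.mul_sum, hx.2, mul_one]

theorem stateAt_regretMatching {s : ℕ} (ℓ : ℕ → Fin s → ℝ) (T : ℕ) (j : Fin s) :
    (regretMatching s).stateAt ℓ T j =
      ∑ t ∈ Finset.range T, (∑ k, ℓ t k * (regretMatching s).decision ℓ t k - ℓ t j) := by
  induction T with
  | zero => rfl
  | succ T ih =>
    rw [Finset.sum_range_succ, ← ih]
    rfl

/-- When the square is expanded, `sum_max_mul_matching` cancels the cross term, so each round adds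
only the squares of the new regrets, each at most `(2 * b) ^ 2`. -/
theorem sum_sq_stateAt_regretMatching_le {s : ℕ} (hs : 1 ≤ s) {ℓ : ℕ → Fin s → ℝ} {b : ℝ}
    (hℓ : ∀ t i, |ℓ t i| ≤ b) (T : ℕ) :
    ∑ j, max ((regretMatching s).stateAt ℓ T j) 0 ^ 2 ≤ T * (s * (2 * b) ^ 2) := by
  induction T with
  | zero => simp [stateAt, regretMatching]
  | succ T ih =>
    set r := (regretMatching s).stateAt ℓ T with hr
    have hstep : ∀ j, (regretMatching s).stateAt ℓ (T + 1) j =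
      r j + (∑ k, ℓ T k * (regretMatching s).recommend r k - ℓ T j) := fun j => rfl
    have hd : ∀ j, (∑ k, ℓ T k * (regretMatching s).recommend r k - ℓ T j) ^ 2 ≤ (2 * b) ^ 2 := by
      intro j
      rw [← sq_abs]
      refine pow_le_pow_left₀ (abs_nonneg _) ?_ 2
      have h1 := abs_sum_mul_le_of_mem_stdSimplex (hℓ T) (regretMatching_recommend_mem hs r)
      have h2 := hℓ T j
      have h3 := abs_sub (∑ k, ℓ T k * (regretMatching s).recommend r k) (ℓ T j)
      linarith
    have h0 := sum_max_mul_matching r (ℓ T)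
    calc ∑ j, max ((regretMatching s).stateAt ℓ (T + 1) j) 0 ^ 2
        ≤ ∑ j, (max (r j) 0 ^ 2 + 2 * (max (r j) 0 *
            (∑ k, ℓ T k * (regretMatching s).recommend r k - ℓ T j)) + (2 * b) ^ 2) := by
          refine Finset.sum_le_sum fun j _ => ?_
          rw [hstep]
          exact (sq_max_add_le _ _).trans (by linarith [hd j])
      _ = ∑ j, max (r j) 0 ^ 2 + s * (2 * b) ^ 2 := by
          rw [Finset.sum_add_distrib, Finset.sum_add_distrib, ← Finset.mul_sum, h0]
          simp
      _ ≤ (T + 1 : ℕ) * (s * (2 * b) ^ 2) := by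
          push_cast
          linarith

theorem hannanConsistent_regretMatching {s : ℕ} (hs : 1 ≤ s) :
    (regretMatching s).HannanConsistent (stdSimplex ℝ (Fin s)) := by
  intro b
  refine ⟨fun T => Real.sqrt (T * (s * (2 * b) ^ 2)), ?_, fun ℓ hℓ T => ?_⟩
  · have h1 : Filter.Tendsto (fun T : ℕ => Real.sqrt ((s * (2 * b) ^ 2) / T)) Filter.atTop
        (nhds (Real.sqrt 0)) :=
      (Real.continuous_sqrt.tendsto 0).comp (tendsto_const_div_atTop_nhds_zero_nat _)
    rw [Real.sqrt_zero] at h1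
    refine h1.congr fun T => ?_
    rcases Nat.eq_zero_or_pos T with rfl | hT
    · simp
    · have hT' : (0 : ℝ) < T := by exact_mod_cast hT
      rw [eq_div_iff hT'.ne', ← Real.sqrt_sq hT'.le, ← Real.sqrt_mul (by positivity)]
      congr 1
      rw [Real.sqrt_sq hT'.le]
      field_simp
  · refine cumRegret_le (stdSimplex_fin_nonempty hs) fun x hx => ?_
    -- Regret against a point of the simplex is the average of the regrets against the vertices, so
    -- a bound for each vertex suffices.
    have hr : ∀ j, (regretMatching s).stateAt ℓ T j ≤ Real.sqrt (T * (s * (2 * b) ^ 2)) := by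
      intro j
      refine (le_max_left _ 0).trans (Real.le_sqrt_of_sq_le ?_)
      exact (Finset.single_le_sum
        (f := fun j => max ((regretMatching s).stateAt ℓ T j) 0 ^ 2)
        (fun _ _ => sq_nonneg _) (Finset.mem_univ j)).trans
        (sum_sq_stateAt_regretMatching_le hs hℓ T)
    calc ∑ t ∈ Finset.range T, ∑ i, ℓ t i * ((regretMatching s).decision ℓ t i - x i)
        = ∑ j, x j * (regretMatching s).stateAt ℓ T j := by
          simp only [stateAt_regretMatching, Finset.mul_sum]
          rw [Finset.sum_comm (s := Finset.univ)]
          refine Finset.sum_congr rfl fun t _ => ?_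
          simp only [mul_sub, Finset.sum_sub_distrib]
          rw [← Finset.sum_mul, hx.2, one_mul]
          congr 1
          exact Finset.sum_congr rfl fun j _ => mul_comm _ _
      _ ≤ ∑ j, x j * Real.sqrt (T * (s * (2 * b) ^ 2)) :=
          Finset.sum_le_sum fun j _ => mul_le_mul_of_nonneg_left (hr j) (hx.1 j)
      _ = _ := by rw [← Finset.sum_mul, hx.2, one_mul]

end OnlineAlgorithm

/-! ## Straight-line programs -/

theorem execList_append (p q : List Instr) (m : Memory) :
    execList (p ++ q) m = execList q (execList p m) :=
  List.foldl_append

theorem execList_cons (q : Instr) (p : List Instr) (m : Memory) :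
    execList (q :: p) m = execList p (q.exec m) :=
  rfl

theorem execList_nil (m : Memory) : execList [] m = m :=
  rfl

/-- Renaming of the registers. -/
def Instr.map (f : ℕ → ℕ) : Instr → Instr
  | zero d => zero (f d)
  | one d => one (f d)
  | copy d a => copy (f d) (f a)
  | add d a b => add (f d) (f a) (f b)
  | sub d a b => sub (f d) (f a) (f b)
  | mul d a b => mul (f d) (f a) (f b)
  | div d a b => div (f d) (f a) (f b)
  | select d c a b => select (f d) (f c) (f a) (f b)

theorem Instr.exec_map_comp {f : ℕ → ℕ} (hf : Function.Injective f) (q : Instr) (m : Memory) :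
    (q.map f).exec m ∘ f = q.exec (m ∘ f) := by
  cases q <;> exact Function.update_comp_eq_of_injective _ hf _ _

theorem Instr.exec_map_of_notMem {f : ℕ → ℕ} {n : ℕ} (hn : ∀ k, n ≠ f k) (q : Instr)
    (m : Memory) : (q.map f).exec m n = m n := by
  cases q <;> exact Function.update_of_ne (hn _) _ _

/-- With `execList_map_of_notMem`, this lets two programs share one memory without interference,
once their registers are renamed into disjoint ranges. -/
theorem execList_map_comp {f : ℕ → ℕ} (hf : Function.Injective f) (p : List Instr)
    (m : Memory) : execList (p.map (Instr.map f)) m ∘ f = execList p (m ∘ f) := by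
  induction p generalizing m with
  | nil => rfl
  | cons q p ih => rw [List.map_cons, execList_cons, ih, Instr.exec_map_comp hf, execList_cons]

theorem execList_map_of_notMem {f : ℕ → ℕ} {n : ℕ} (hn : ∀ k, n ≠ f k) (p : List Instr)
    (m : Memory) : execList (p.map (Instr.map f)) m n = m n := by
  induction p generalizing m with
  | nil => rfl
  | cons q p ih => rw [List.map_cons, execList_cons, ih, Instr.exec_map_of_notMem hn]

/-- Instructions with different destinations, none of which reads the destination of another,
act as if they were executed in parallel. -/
theorem execList_parallel {κ : Type} {I : κ → Instr} {d : κ → ℕ} (v : κ → Memory → ℝ)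
    (hI : ∀ k m, (I k).exec m = Function.update m (d k) (v k m)) (hd : Function.Injective d)
    (hv : ∀ k m m', (∀ n, (∀ k', n = d k' → k' = k) → m n = m' n) → v k m = v k m')
    {l : List κ} (hl : l.Nodup) (m : Memory) :
    (∀ k ∈ l, execList (l.map I) m (d k) = v k m) ∧
      ∀ n, (∀ k, n ≠ d k) → execList (l.map I) m n = m n := by
  have frame : ∀ (l : List κ) (m : Memory) (n : ℕ), (∀ k ∈ l, n ≠ d k) →
      execList (l.map I) m n = m n := by
    intro l
    induction l with
    | nil => intro m n _; rfl
    | cons k l ih =>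
      intro m n hn
      rw [List.map_cons, execList_cons, ih _ n fun k' hk' => hn k' (List.mem_cons_of_mem _ hk'),
        hI, Function.update_of_ne (hn k List.mem_cons_self)]
  refine ⟨?_, fun n hn => frame l m n fun k _ => hn k⟩
  induction l generalizing m with
  | nil => simp
  | cons k l ih =>
    rw [List.nodup_cons] at hl
    intro k' hk'
    rw [List.map_cons, execList_cons]
    rcases List.mem_cons.1 hk' with rfl | hk'
    · rw [frame, hI, Function.update_self]
      rintro k'' hk'' h
      exact hl.1 (hd h ▸ hk'')
    · rw [ih hl.2 _ k' hk']
      refine hv k' _ _ fun n hn => ?_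
      rw [hI, Function.update_of_ne]
      rintro rfl
      exact hl.1 (hn k rfl ▸ hk')

theorem execList_accumulate {κ : Type} (c : ℕ) (b : κ → ℕ) (hb : ∀ k, b k ≠ c) (D : Finset κ)
    (m : Memory) :
    execList (D.toList.map fun k => Instr.add c c (b k)) m =
      Function.update m c (m c + ∑ k ∈ D, m (b k)) := by
  rw [← Finset.sum_map_toList]
  generalize D.toList = l
  induction l generalizing m with
  | nil => simp [execList_nil]
  | cons k l ih =>
    rw [List.map_cons, execList_cons, ih]
    simp only [Instr.exec, Function.update_idem, Function.update_self, List.map_cons,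
      List.sum_cons, Function.update_of_ne (hb _), add_assoc]

/-- A program whose memory simulates the states of `A` makes the same decisions as `A`. -/
theorem Program.decision_eq_of_simulation {ι : Type} (P : Program ι) (A : OnlineAlgorithm ι)
    (Rel : Memory → A.State → Prop) (h0 : Rel (fun _ => 0) A.init)
    (hrec : ∀ m s, Rel m s → ∀ i, execList P.recommend m (P.port i) = A.recommend s i)
    (hobs : ∀ m s, Rel m s → ∀ ℓ, Rel (P.toAlgorithm.observe m ℓ) (A.observe s ℓ))
    (ℓ : ℕ → ι → ℝ) (t : ℕ) : P.toAlgorithm.decision ℓ t = A.decision ℓ t := by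
  have h : Rel (P.toAlgorithm.stateAt ℓ t) (A.stateAt ℓ t) := by
    induction t with
    | zero => exact h0
    | succ t ih => exact hobs _ _ ih _
  exact funext fun i => hrec _ _ h i

/-! ### A program for regret matching -/

namespace OnlineAlgorithm

/-- A program for regret matching on `Δ^s`. The registers `3 j + 4`, `3 j + 5`, `3 j + 6` are
the port, the regret and the decision of coordinate `j`. -/
noncomputable def regretMatchingProgram (s : ℕ) : Program (Fin s) where
  port := ⟨fun j => 3 * j + 4, fun i j h => Fin.ext (by dsimp only at h; omega)⟩
  recommend :=
    -- Registers `0` and `1` hold these constants, `2` collects the sum of the positive parts, `3`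
    -- the sum of the weights. The decision is kept in `3 j + 6` as well, since the loss will
    -- overwrite the ports.
    [Instr.zero 0, Instr.one 1, Instr.zero 2, Instr.zero 3] ++
    ((Finset.univ : Finset (Fin s)).toList.map fun j : Fin s =>
      Instr.select (3 * j + 6) (3 * j + 5) (3 * j + 5) 0) ++
    ((Finset.univ : Finset (Fin s)).toList.map fun j : Fin s => Instr.add 2 2 (3 * j + 6)) ++
    ((Finset.univ : Finset (Fin s)).toList.map fun j : Fin s =>
      Instr.select (3 * j + 6) 2 (3 * j + 6) 1) ++
    ((Finset.univ : Finset (Fin s)).toList.map fun j : Fin s => Instr.add 3 3 (3 * j + 6)) ++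
    ((Finset.univ : Finset (Fin s)).toList.map fun j : Fin s =>
      Instr.div (3 * j + 6) (3 * j + 6) 3) ++
    ((Finset.univ : Finset (Fin s)).toList.map fun j : Fin s =>
      Instr.copy (3 * j + 4) (3 * j + 6))
  observe :=
    -- Register `2` now collects the inner product of loss and decision.
    [Instr.zero 2] ++
    ((Finset.univ : Finset (Fin s)).toList.map fun j : Fin s =>
      Instr.mul (3 * j + 6) (3 * j + 4) (3 * j + 6)) ++
    ((Finset.univ : Finset (Fin s)).toList.map fun j : Fin s => Instr.add 2 2 (3 * j + 6)) ++
    ((Finset.univ : Finset (Fin s)).toList.map fun j : Fin s =>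
      Instr.sub (3 * j + 4) 2 (3 * j + 4)) ++
    ((Finset.univ : Finset (Fin s)).toList.map fun j : Fin s =>
      Instr.add (3 * j + 5) (3 * j + 5) (3 * j + 4))

theorem steps_regretMatchingProgram (s : ℕ) : (regretMatchingProgram s).steps = 10 * s + 5 := by
  simp only [Program.steps, regretMatchingProgram, List.length_append, List.length_map,
    Finset.length_toList, Finset.card_univ, Fintype.card_fin, List.length_cons, List.length_nil]
  omega

theorem exec_recommend_regretMatchingProgram {s : ℕ} (m : Memory) (r : Fin s → ℝ)
    (hr : ∀ j : Fin s, m (3 * j + 5) = r j) (j : Fin s) :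
    execList (regretMatchingProgram s).recommend m (3 * j + 4) =
        (regretMatching s).recommend r j ∧
      execList (regretMatchingProgram s).recommend m (3 * j + 5) = r j ∧
      execList (regretMatchingProgram s).recommend m (3 * j + 6) =
        (regretMatching s).recommend r j := by
  have hnd := Finset.nodup_toList (Finset.univ : Finset (Fin s))
  have hmem : ∀ j : Fin s, j ∈ (Finset.univ : Finset (Fin s)).toList := by simp
  have inj : Function.Injective fun j : Fin s => 3 * (j : ℕ) + 6 :=
    fun i j h => Fin.ext (by dsimp only at h; omega)
  have inj4 : Function.Injective fun j : Fin s => 3 * (j : ℕ) + 4 :=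
    fun i j h => Fin.ext (by dsimp only at h; omega)
  simp only [regretMatchingProgram, execList_append]
  rw [execList_accumulate 3 _ (by intro k; omega), execList_accumulate 2 _ (by intro k; omega)]
  simp only [execList_cons, execList_nil, Instr.exec]
  set m₁ : Memory := Function.update (Function.update (Function.update (Function.update
    m 0 0) 1 1) 2 0) 3 0 with hm₁
  have e0 : m₁ 0 = 0 := by simp [hm₁]
  have e1 : m₁ 1 = 1 := by simp [hm₁]
  have e2 : m₁ 2 = 0 := by simp [hm₁]
  have e3 : m₁ 3 = 0 := by simp [hm₁]
  have er : ∀ j : Fin s, m₁ (3 * j + 5) = r j := by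
    intro j
    rw [← hr j]
    simp [hm₁]
  clear_value m₁
  obtain ⟨a1, a2⟩ := execList_parallel
    (I := fun j : Fin s => Instr.select (3 * j + 6) (3 * j + 5) (3 * j + 5) 0)
    (fun j m => open Classical in if 0 < m (3 * j + 5) then m (3 * j + 5) else m 0)
    (fun _ _ => rfl) inj
    (fun k m m' h => by rw [h (3 * k + 5) (by intros; omega), h 0 (by intros; omega)]) hnd m₁
  generalize execList _ m₁ = m₂ at *
  have b1 : ∀ j : Fin s, m₂ (3 * j + 6) = max (r j) 0 := by
    intro j
    rw [a1 j (hmem j), er, e0]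
    split_ifs with h
    · exact (max_eq_left h.le).symm
    · exact (max_eq_right (not_lt.1 h)).symm
  set m₃ := Function.update m₂ 2 (m₂ 2 + ∑ k : Fin s, m₂ (3 * k + 6)) with hm₃
  have c1 : ∀ j : Fin s, m₃ (3 * j + 6) = max (r j) 0 := by
    intro j
    rw [hm₃, Function.update_of_ne (by omega), b1]
  have c2 : m₃ 2 = ∑ k, max (r k) 0 := by
    rw [hm₃, Function.update_self, a2 2 (by intro k; omega), e2, zero_add]
    exact Finset.sum_congr rfl fun k _ => b1 k
  have c3 : ∀ n : ℕ, (∀ k : Fin s, n ≠ 3 * k + 6) → n ≠ 2 → m₃ n = m₁ n := by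
    intro n hn h2
    rw [hm₃, Function.update_of_ne h2, a2 n hn]
  clear_value m₃
  obtain ⟨d1, d2⟩ := execList_parallel
    (I := fun j : Fin s => Instr.select (3 * j + 6) 2 (3 * j + 6) 1)
    (fun j m => open Classical in if 0 < m 2 then m (3 * j + 6) else m 1)
    (fun _ _ => rfl) inj
    (fun k m m' h => by rw [h (3 * k + 6) (by intros; omega), h 2 (by intros; omega),
      h 1 (by intros; omega)]) hnd m₃
  generalize execList _ m₃ = m₄ at *
  have f1 : ∀ j : Fin s, m₄ (3 * j + 6) = matchingWeight r j := by
    intro j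
    rw [d1 j (hmem j), c2, c1, c3 1 (by intro k; omega) (by omega), e1]
    rfl
  set m₅ := Function.update m₄ 3 (m₄ 3 + ∑ k : Fin s, m₄ (3 * k + 6)) with hm₅
  have g1 : ∀ j : Fin s, m₅ (3 * j + 6) = matchingWeight r j := by
    intro j
    rw [hm₅, Function.update_of_ne (by omega), f1]
  have g2 : m₅ 3 = ∑ k, matchingWeight r k := by
    rw [hm₅, Function.update_self, d2 3 (by intro k; omega), c3 3 (by intro k; omega) (by omega),
      e3, zero_add]
    exact Finset.sum_congr rfl fun k _ => f1 k
  have g3 : ∀ j : Fin s, m₅ (3 * j + 5) = r j := by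
    intro j
    rw [hm₅, Function.update_of_ne (by omega), d2 _ (by intro k; omega),
      c3 _ (by intro k; omega) (by omega), er]
  clear_value m₅
  obtain ⟨i1, i2⟩ := execList_parallel
    (I := fun j : Fin s => Instr.div (3 * j + 6) (3 * j + 6) 3)
    (fun j m => m (3 * j + 6) / m 3)
    (fun _ _ => rfl) inj
    (fun k m m' h => by rw [h (3 * k + 6) (by intros; omega), h 3 (by intros; omega)]) hnd m₅
  generalize execList _ m₅ = m₆ at *
  obtain ⟨j1, j2⟩ := execList_parallel
    (I := fun j : Fin s => Instr.copy (3 * j + 4) (3 * j + 6))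
    (fun j m => m (3 * j + 6))
    (fun _ _ => rfl) inj4
    (fun k m m' h => by rw [h (3 * k + 6) (by intros; omega)]) hnd m₆
  generalize execList _ m₆ = m₇ at *
  refine ⟨?_, ?_, ?_⟩
  · rw [j1 j (hmem j), i1 j (hmem j), g1, g2]
    rfl
  · rw [j2 _ (by intro k; omega), i2 _ (by intro k; omega), g3]
  · rw [j2 _ (by intro k; omega), i1 j (hmem j), g1, g2]
    rfl

theorem exec_observe_regretMatchingProgram {s : ℕ} (m : Memory) (r x ℓ : Fin s → ℝ)
    (hr : ∀ j : Fin s, m (3 * j + 5) = r j) (hx : ∀ j : Fin s, m (3 * j + 6) = x j)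
    (hl : ∀ j : Fin s, m (3 * j + 4) = ℓ j) (j : Fin s) :
    execList (regretMatchingProgram s).observe m (3 * j + 5) =
      r j + (∑ k, ℓ k * x k - ℓ j) := by
  have hnd := Finset.nodup_toList (Finset.univ : Finset (Fin s))
  have hmem : ∀ j : Fin s, j ∈ (Finset.univ : Finset (Fin s)).toList := by simp
  have inj : ∀ c, Function.Injective fun j : Fin s => 3 * (j : ℕ) + c :=
    fun c i j h => Fin.ext (by dsimp only at h; omega)
  simp only [regretMatchingProgram, execList_append]
  rw [execList_accumulate 2 _ (by intro k; omega)]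
  simp only [execList_cons, execList_nil, Instr.exec]
  set m₁ : Memory := Function.update m 2 0 with hm₁
  have e2 : m₁ 2 = 0 := by simp [hm₁]
  have er : ∀ n, n ≠ 2 → m₁ n = m n := fun n hn => Function.update_of_ne hn _ _
  clear_value m₁
  obtain ⟨a1, a2⟩ := execList_parallel
    (I := fun j : Fin s => Instr.mul (3 * j + 6) (3 * j + 4) (3 * j + 6))
    (fun j m => m (3 * j + 4) * m (3 * j + 6))
    (fun _ _ => rfl) (inj 6)
    (fun k m m' h => by rw [h (3 * k + 4) (by intros; omega), h (3 * k + 6) (by intros; omega)])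
    hnd m₁
  generalize execList _ m₁ = m₂ at *
  set m₃ := Function.update m₂ 2 (m₂ 2 + ∑ k : Fin s, m₂ (3 * k + 6)) with hm₃
  have c2 : m₃ 2 = ∑ k, ℓ k * x k := by
    rw [hm₃, Function.update_self, a2 2 (by intro k; omega), e2, zero_add]
    refine Finset.sum_congr rfl fun k _ => ?_
    rw [a1 k (hmem k), er _ (by omega), er _ (by omega), hl, hx]
  have c3 : ∀ n : ℕ, (∀ k : Fin s, n ≠ 3 * k + 6) → n ≠ 2 → m₃ n = m n := by
    intro n hn h2
    rw [hm₃, Function.update_of_ne h2, a2 n hn, er n h2]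
  clear_value m₃
  obtain ⟨d1, d2⟩ := execList_parallel
    (I := fun j : Fin s => Instr.sub (3 * j + 4) 2 (3 * j + 4))
    (fun j m => m 2 - m (3 * j + 4))
    (fun _ _ => rfl) (inj 4)
    (fun k m m' h => by rw [h (3 * k + 4) (by intros; omega), h 2 (by intros; omega)])
    hnd m₃
  generalize execList _ m₃ = m₄ at *
  obtain ⟨f1, f2⟩ := execList_parallel
    (I := fun j : Fin s => Instr.add (3 * j + 5) (3 * j + 5) (3 * j + 4))
    (fun j m => m (3 * j + 5) + m (3 * j + 4))
    (fun _ _ => rfl) (inj 5)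
    (fun k m m' h => by rw [h (3 * k + 4) (by intros; omega), h (3 * k + 5) (by intros; omega)])
    hnd m₄
  rw [f1 j (hmem j), d1 j (hmem j), d2 _ (by intro k; omega), c2,
    c3 _ (by intro k; omega) (by omega), c3 _ (by intro k; omega) (by omega), hl, hr]

theorem runsInTime_regretMatching (s : ℕ) : (regretMatching s).RunsInTime (10 * s + 5) := by
  refine ⟨regretMatchingProgram s, (steps_regretMatchingProgram s).le, ?_⟩
  refine Program.decision_eq_of_simulation _ _
    (fun m r => ∀ j : Fin s, m (3 * j + 5) = (r : Fin s → ℝ) j) (fun _ => rfl) ?_ ?_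
  · intro m r h i
    exact (exec_recommend_regretMatchingProgram m r h i).1
  · intro m r h ℓ j
    have hrec := exec_recommend_regretMatchingProgram m r h
    refine exec_observe_regretMatchingProgram _ r ((regretMatching s).recommend r) ℓ ?_ ?_ ?_ j
    · intro k
      rw [Function.extend_apply', (hrec k).2.1]
      rintro ⟨i, hi⟩
      change 3 * (i : ℕ) + 4 = _ at hi
      omega
    · intro k
      rw [Function.extend_apply', (hrec k).2.2]
      rintro ⟨i, hi⟩
      change 3 * (i : ℕ) + 4 = _ at hi
      omega
    · intro k
      exact (regretMatchingProgram s).port.injective.extend_apply ℓ _ k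

/-! ### A program for the regret circuit -/

theorem runsInTime_alwaysOne : alwaysOne.RunsInTime 1 := by
  refine ⟨⟨⟨fun _ => 0, fun _ _ _ => rfl⟩, [Instr.one 0], []⟩, le_rfl, ?_⟩
  refine Program.decision_eq_of_simulation _ _ (fun _ _ => True) trivial
    (fun m _ _ _ => ?_) fun _ _ _ _ => trivial
  change Function.update m 0 (1 : ℝ) 0 = 1
  exact Function.update_self _ _ _

theorem RunsInTime.mono {ι : Type} {A : OnlineAlgorithm ι} {n n' : ℕ} (h : A.RunsInTime n)
    (hn : n ≤ n') : A.RunsInTime n' :=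
  let ⟨P, hP, hd⟩ := h
  ⟨P, hP.trans hn, hd⟩

theorem RunsInTime.reindex {α β : Type} {A : OnlineAlgorithm α} {n : ℕ} (h : A.RunsInTime n)
    (e : α ≃ β) : (A.reindex e).RunsInTime n := by
  obtain ⟨P, hP, hd⟩ := h
  refine ⟨⟨e.symm.toEmbedding.trans P.port, P.recommend, P.observe⟩, hP, fun ℓ t => ?_⟩
  have hs : ∀ t, (Program.toAlgorithm ⟨e.symm.toEmbedding.trans P.port, P.recommend,
      P.observe⟩).stateAt ℓ t = P.toAlgorithm.stateAt (fun t i => ℓ t (e i)) t := by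
    intro t
    induction t with
    | zero => rfl
    | succ t ih =>
      simp only [stateAt, ih]
      simp only [Program.toAlgorithm]
      congr 1
      funext n
      by_cases hn : ∃ i, P.port i = n
      · obtain ⟨i, rfl⟩ := hn
        rw [P.port.injective.extend_apply]
        have := (e.symm.toEmbedding.trans P.port).injective.extend_apply (ℓ t)
          (execList P.recommend (P.toAlgorithm.stateAt (fun t i => ℓ t (e i)) t)) (e i)
        rwa [show (e.symm.toEmbedding.trans P.port) (e i) = P.port i by simp] at this
      · rw [Function.extend_apply' _ _ _ hn, Function.extend_apply']
        rintro ⟨j, hj⟩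
        exact hn ⟨e.symm j, hj⟩
  funext j
  rw [decision_reindex, ← hd]
  simp only [decision, hs]
  rfl

/-- A program for the regret circuit via the sum of the coordinates in `D`, built from programs
for its two parts. The even registers are those of `P`, the registers `4 n + 1` those of `Q`. -/
noncomputable def scaledExtProgram {α β : Type} [Fintype β] (P : Program α) (D : Finset α)
    (Q : Program β) : Program (α ⊕ β) where
  -- The ports of the second component cannot be those of `Q`, which must keep `y` for the
  -- observation while `h(x) y` is output. They are `8 n + 7`. The accumulator is `3`, and the
  -- products for the inner product `⟨ℓ_y, y⟩` use `8 n + 11`, where `8 n + 3` would collide with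
  -- the accumulator.
  port := ⟨Sum.elim (fun i => 2 * P.port i) (fun j => 8 * Q.port j + 7), by
    rintro (i | i) (j | j) h <;> simp only [Sum.elim_inl, Sum.elim_inr] at h
    · exact congrArg _ (P.port.injective (by omega))
    · omega
    · omega
    · exact congrArg _ (Q.port.injective (by omega))⟩
  recommend :=
    P.recommend.map (Instr.map fun n => 2 * n) ++
    Q.recommend.map (Instr.map fun n => 4 * n + 1) ++
    [Instr.zero 3] ++
    (D.toList.map fun i => Instr.add 3 3 (2 * P.port i)) ++
    ((Finset.univ : Finset β).toList.map fun j =>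
      Instr.mul (8 * Q.port j + 7) 3 (4 * Q.port j + 1))
  observe :=
    [Instr.zero 3] ++
    ((Finset.univ : Finset β).toList.map fun j =>
      Instr.mul (8 * Q.port j + 11) (8 * Q.port j + 7) (4 * Q.port j + 1)) ++
    ((Finset.univ : Finset β).toList.map fun j => Instr.add 3 3 (8 * Q.port j + 11)) ++
    -- Only now, with `⟨ℓ_y, y⟩` in register `3`, may the loss replace `y` at the ports of `Q`.
    ((Finset.univ : Finset β).toList.map fun j =>
      Instr.copy (4 * Q.port j + 1) (8 * Q.port j + 7)) ++
    Q.observe.map (Instr.map fun n => 4 * n + 1) ++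
    (D.toList.map fun i => Instr.add (2 * P.port i) (2 * P.port i) 3) ++
    P.observe.map (Instr.map fun n => 2 * n)

theorem steps_scaledExtProgram {α β : Type} [Fintype β] (P : Program α) (D : Finset α)
    (Q : Program β) : (scaledExtProgram P D Q).steps =
      P.steps + Q.steps + 4 * Fintype.card β + 2 * D.card + 2 := by
  simp only [Program.steps, scaledExtProgram, List.length_append, List.length_map,
    Finset.length_toList, Finset.card_univ, List.length_cons, List.length_nil]
  omega

theorem exec_recommend_scaledExtProgram {α β : Type} [Fintype β] (P : Program α) (D : Finset α)
    (Q : Program β) (m : Memory) :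
    (fun n => execList (scaledExtProgram P D Q).recommend m (2 * n)) =
        execList P.recommend (fun n => m (2 * n)) ∧
      (fun n => execList (scaledExtProgram P D Q).recommend m (4 * n + 1)) =
        execList Q.recommend (fun n => m (4 * n + 1)) ∧
      ∀ j, execList (scaledExtProgram P D Q).recommend m (8 * Q.port j + 7) =
        (∑ i ∈ D, execList P.recommend (fun n => m (2 * n)) (P.port i)) *
          execList Q.recommend (fun n => m (4 * n + 1)) (Q.port j) := by
  have hnd := Finset.nodup_toList (Finset.univ : Finset β)
  have hmem : ∀ j : β, j ∈ (Finset.univ : Finset β).toList := by simp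
  have inj : Function.Injective fun j : β => 8 * Q.port j + 7 :=
    fun i j h => Q.port.injective (by dsimp only at h; omega)
  have iA : Function.Injective fun n : ℕ => 2 * n := fun i j h => by dsimp only at h; omega
  have iB : Function.Injective fun n : ℕ => 4 * n + 1 := fun i j h => by dsimp only at h; omega
  simp only [scaledExtProgram, execList_append]
  rw [execList_accumulate 3 _ (by intro k; omega)]
  simp only [execList_cons, execList_nil, Instr.exec]
  have a1 : ∀ n, execList (P.recommend.map (Instr.map fun n => 2 * n)) m (2 * n) =
      execList P.recommend (fun n => m (2 * n)) n :=
    congrFun (execList_map_comp iA P.recommend m)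
  have a2 : ∀ n, (∀ k, n ≠ 2 * k) → execList (P.recommend.map (Instr.map fun n => 2 * n)) m n =
      m n := fun n hn => execList_map_of_notMem hn _ _
  generalize execList (P.recommend.map (Instr.map fun n => 2 * n)) m = m₁ at *
  have b1 : ∀ n, execList (Q.recommend.map (Instr.map fun n => 4 * n + 1)) m₁ (4 * n + 1) =
      execList Q.recommend (fun n => m (4 * n + 1)) n := by
    intro n
    have e : (fun n => m (4 * n + 1)) = m₁ ∘ fun n => 4 * n + 1 :=
      funext fun n => (a2 _ (by intro k; omega)).symm
    rw [e, ← execList_map_comp iB]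
    rfl
  have b2 : ∀ n, (∀ k, n ≠ 4 * k + 1) →
      execList (Q.recommend.map (Instr.map fun n => 4 * n + 1)) m₁ n = m₁ n :=
    fun n hn => execList_map_of_notMem hn _ _
  generalize execList (Q.recommend.map (Instr.map fun n => 4 * n + 1)) m₁ = m₂ at *
  set m₃ : Memory := Function.update (Function.update m₂ 3 0) 3
    (Function.update m₂ 3 0 3 + ∑ k ∈ D, Function.update m₂ 3 0 (2 * P.port k)) with hm₃
  have c1 : ∀ n, n ≠ 3 → m₃ n = m₂ n := by
    intro n hn
    rw [hm₃, Function.update_of_ne hn, Function.update_of_ne hn]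
  have c2 : m₃ 3 = ∑ i ∈ D, execList P.recommend (fun n => m (2 * n)) (P.port i) := by
    rw [hm₃, Function.update_self, Function.update_self, zero_add]
    refine Finset.sum_congr rfl fun i _ => ?_
    rw [Function.update_of_ne (by omega), b2 _ (by intro k; omega), a1]
  clear_value m₃
  obtain ⟨d1, d2⟩ := execList_parallel
    (I := fun j : β => Instr.mul (8 * Q.port j + 7) 3 (4 * Q.port j + 1))
    (fun j m => m 3 * m (4 * Q.port j + 1))
    (fun _ _ => rfl) inj
    (fun k m m' h => by rw [h 3 (by intros; omega), h (4 * Q.port k + 1) (by intros; omega)])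
    hnd m₃
  generalize execList _ m₃ = m₄ at *
  refine ⟨?_, ?_, ?_⟩
  · funext n
    rw [d2 _ (by intro k; omega), c1 _ (by omega), b2 _ (by intro k; omega), a1]
  · funext n
    rw [d2 _ (by intro k; omega), c1 _ (by omega), b1]
  · intro j
    rw [d1 j (hmem j), c1 (4 * Q.port j + 1) (by omega), b1, c2]

open Classical in
theorem exec_observe_scaledExtProgram {α β : Type} [Fintype β] (P : Program α) (D : Finset α)
    (Q : Program β) (m mA mB : Memory) (ℓA : α → ℝ) (ℓB y : β → ℝ)
    (hA : ∀ n, m (2 * n) = Function.extend P.port ℓA mA n)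
    (hB : ∀ n, m (4 * n + 1) = mB n) (hy : ∀ j, mB (Q.port j) = y j)
    (hl : ∀ j, m (8 * Q.port j + 7) = ℓB j) :
    (fun n => execList (scaledExtProgram P D Q).observe m (2 * n)) =
        execList P.observe (Function.extend P.port
          (fun i => ℓA i + (∑ j, ℓB j * y j) * if i ∈ D then 1 else 0) mA) ∧
      (fun n => execList (scaledExtProgram P D Q).observe m (4 * n + 1)) =
        execList Q.observe (Function.extend Q.port ℓB mB) := by
  have hnd := Finset.nodup_toList (Finset.univ : Finset β)
  have hmem : ∀ j : β, j ∈ (Finset.univ : Finset β).toList := by simp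
  have inj : ∀ c, Function.Injective fun j : β => 8 * Q.port j + c :=
    fun c i j h => Q.port.injective (by dsimp only at h; omega)
  have inj' : Function.Injective fun j : β => 4 * Q.port j + 1 :=
    fun i j h => Q.port.injective (by dsimp only at h; omega)
  have injP : Function.Injective fun i : α => 2 * P.port i :=
    fun i j h => P.port.injective (by dsimp only at h; omega)
  have iA : Function.Injective fun n : ℕ => 2 * n := fun i j h => by dsimp only at h; omega
  have iB : Function.Injective fun n : ℕ => 4 * n + 1 := fun i j h => by dsimp only at h; omega
  simp only [scaledExtProgram, execList_append]
  rw [execList_accumulate 3 _ (by intro k; omega)]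
  simp only [execList_cons, execList_nil, Instr.exec]
  set m₁ : Memory := Function.update m 3 0 with hm₁
  have a3 : m₁ 3 = 0 := by simp [hm₁]
  have a4 : ∀ n, n ≠ 3 → m₁ n = m n := fun n hn => Function.update_of_ne hn _ _
  clear_value m₁
  obtain ⟨b1, b2⟩ := execList_parallel
    (I := fun j : β => Instr.mul (8 * Q.port j + 11) (8 * Q.port j + 7) (4 * Q.port j + 1))
    (fun j m => m (8 * Q.port j + 7) * m (4 * Q.port j + 1))
    (fun _ _ => rfl) (inj 11)
    (fun k m m' h => by rw [h (8 * Q.port k + 7) (by intros; omega),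
      h (4 * Q.port k + 1) (by intros; omega)])
    hnd m₁
  generalize execList _ m₁ = m₂ at *
  set m₃ : Memory := Function.update m₂ 3 (m₂ 3 + ∑ k, m₂ (8 * Q.port k + 11)) with hm₃
  have c1 : ∀ n, n ≠ 3 → (∀ k, n ≠ 8 * k + 11) → m₃ n = m n := by
    intro n hn h
    rw [hm₃, Function.update_of_ne hn, b2 _ fun k => h _, a4 _ hn]
  have c2 : m₃ 3 = ∑ j, ℓB j * y j := by
    rw [hm₃, Function.update_self, b2 3 (by intro k; omega), a3, zero_add]
    refine Finset.sum_congr rfl fun j _ => ?_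
    rw [b1 j (hmem j), a4 _ (by omega), a4 _ (by omega), hl, hB, hy]
  clear_value m₃
  obtain ⟨d1, d2⟩ := execList_parallel
    (I := fun j : β => Instr.copy (4 * Q.port j + 1) (8 * Q.port j + 7))
    (fun j m => m (8 * Q.port j + 7))
    (fun _ _ => rfl) inj'
    (fun k m m' h => by rw [h (8 * Q.port k + 7) (by intros; omega)])
    hnd m₃
  generalize execList _ m₃ = m₄ at *
  have e1 : (m₄ ∘ fun n => 4 * n + 1) = Function.extend Q.port ℓB mB := by
    funext n
    simp only [Function.comp]
    by_cases hn : ∃ j, Q.port j = n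
    · obtain ⟨j, rfl⟩ := hn
      rw [Q.port.injective.extend_apply, d1 j (hmem j), c1 _ (by omega) (by intro k; omega), hl]
    · rw [Function.extend_apply' _ _ _ hn, d2, c1 _ (by omega) (by intro k; omega), hB]
      intro k hk
      exact hn ⟨k, by omega⟩
  have f1 : ∀ n, execList (Q.observe.map (Instr.map fun n => 4 * n + 1)) m₄ (4 * n + 1) =
      execList Q.observe (Function.extend Q.port ℓB mB) n := by
    rw [← e1]
    exact congrFun (execList_map_comp iB Q.observe m₄)
  have f2 : ∀ n, (∀ k, n ≠ 4 * k + 1) →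
      execList (Q.observe.map (Instr.map fun n => 4 * n + 1)) m₄ n = m₄ n :=
    fun n hn => execList_map_of_notMem hn _ _
  generalize execList (Q.observe.map (Instr.map fun n => 4 * n + 1)) m₄ = m₅ at *
  have hD := Finset.nodup_toList D
  obtain ⟨g1, g2⟩ := execList_parallel
    (I := fun i : α => Instr.add (2 * P.port i) (2 * P.port i) 3)
    (fun i m => m (2 * P.port i) + m 3)
    (fun _ _ => rfl) injP
    (fun k m m' h => by rw [h 3 (by intros; omega),
      h (2 * P.port k) (fun k' hk' => P.port.injective (by omega))])
    hD m₅
  -- The frame statement `g2` leaves out the ports of all coordinates, also of those outside `D`,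
  -- although no instruction writes to the latter.
  have g3 : ∀ n, (∀ k ∈ D, n ≠ 2 * P.port k) → execList (D.toList.map fun i : α =>
      Instr.add (2 * P.port i) (2 * P.port i) 3) m₅ n = m₅ n := by
    intro n hn
    by_cases h : ∃ k, n = 2 * P.port k
    · obtain ⟨k, rfl⟩ := h
      have hk : k ∉ D := fun hk => hn k hk rfl
      have frame : ∀ (l : List α) (m : Memory), k ∉ l → execList (l.map fun i : α =>
          Instr.add (2 * P.port i) (2 * P.port i) 3) m (2 * P.port k) = m (2 * P.port k) := by
        intro l
        induction l with
        | nil => intro m _; rfl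
        | cons i l ih =>
          intro m hl
          rw [List.mem_cons, not_or] at hl
          rw [List.map_cons, execList_cons, ih _ hl.2]
          exact Function.update_of_ne (fun h => hl.1 (injP h)) _ _
      exact frame _ _ (by simpa using hk)
    · exact g2 n fun k hk => h ⟨k, hk⟩
  generalize execList _ m₅ = m₆ at *
  have h1 : (m₆ ∘ fun n => 2 * n) = Function.extend P.port
      (fun i => ℓA i + (∑ j, ℓB j * y j) * if i ∈ D then 1 else 0) mA := by
    funext n
    simp only [Function.comp]
    have key : m₅ (2 * n) = Function.extend P.port ℓA mA n := by
      rw [f2 _ (by intro k; omega), d2 _ (by intro k; omega), c1 _ (by omega) (by intro k; omega),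
        hA]
    by_cases hn : ∃ i, P.port i = n
    · obtain ⟨i, rfl⟩ := hn
      rw [P.port.injective.extend_apply] at key ⊢
      by_cases hi : i ∈ D
      · rw [g1 i (by simpa using hi), key, f2 _ (by intro k; omega), d2 _ (by intro k; omega), c2,
          if_pos hi, mul_one]
      · rw [g3, key, if_neg hi, mul_zero, add_zero]
        intro k hk h
        exact hi (P.port.injective (show P.port i = P.port k by omega) ▸ hk)
    · rw [Function.extend_apply' _ _ _ hn] at key ⊢
      rw [g3, key]
      intro k _ h
      exact hn ⟨k, by omega⟩
  constructor
  · rw [← h1]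
    exact execList_map_comp iA P.observe m₆
  · funext n
    rw [execList_map_of_notMem (by intro k; omega), g2 _ (by intro k; omega), f1]

/-- If the linear function is the sum of the coordinates in `D`, the regret circuit for the
scaled extension needs a number of steps linear in the sizes of `D` and of `β`, in addition to
the steps of its two parts. -/
theorem RunsInTime.scaledExt {α β : Type} [Fintype α] [Fintype β] {A : OnlineAlgorithm α}
    {B : OnlineAlgorithm β} {n n' : ℕ} (hA : A.RunsInTime n) (hB : B.RunsInTime n')
    (a : α → ℝ) (D : Finset α) (h1 : ∀ i ∈ D, a i = 1) (h0 : ∀ i ∉ D, a i = 0) :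
    (A.scaledExt a B).RunsInTime (n + n' + 4 * Fintype.card β + 2 * D.card + 2) := by
  classical
  obtain ⟨P, hP, hPA⟩ := hA
  obtain ⟨Q, hQ, hQB⟩ := hB
  have ha : a = fun i => if i ∈ D then 1 else 0 := by
    funext i
    split_ifs with hi
    · exact h1 i hi
    · exact h0 i hi
  have hsum : ∀ x : α → ℝ, ∑ i, a i * x i = ∑ i ∈ D, x i := fun x => by simp [ha]
  refine ⟨scaledExtProgram P D Q, by rw [steps_scaledExtProgram]; omega, fun ℓ t => ?_⟩
  -- The decisions depend only on those of the two parts, so both parts may be replaced by what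
  -- their programs realize. Then the states are memories, and the simulation relation says which
  -- registers hold them.
  have hL : lossLeft a Q.toAlgorithm ℓ = lossLeft a B ℓ := by
    funext t i
    simp only [lossLeft, hQB]
  have hS : (P.toAlgorithm.scaledExt a Q.toAlgorithm).decision ℓ t =
      (A.scaledExt a B).decision ℓ t := by
    simp only [decision_scaledExt, hL, hPA, hQB]
  rw [← hS]
  refine Program.decision_eq_of_simulation _ (P.toAlgorithm.scaledExt a Q.toAlgorithm)
    (fun m s => (fun n => m (2 * n)) = s.1 ∧ (fun n => m (4 * n + 1)) = s.2) ⟨rfl, rfl⟩ ?_ ?_ ℓ t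
  · rintro m ⟨sA, sB⟩ ⟨rfl, rfl⟩ k
    obtain ⟨r1, r2, r3⟩ := exec_recommend_scaledExtProgram P D Q m
    rcases k with i | j
    · exact congrFun r1 (P.port i)
    · refine (r3 j).trans ?_
      simp only [OnlineAlgorithm.scaledExt, Sum.elim_inr, Pi.smul_apply, smul_eq_mul, hsum]
      rfl
  · rintro m ⟨sA, sB⟩ ⟨rfl, rfl⟩ l
    obtain ⟨r1, r2, r3⟩ := exec_recommend_scaledExtProgram P D Q m
    have := exec_observe_scaledExtProgram P D Q
      (Function.extend (scaledExtProgram P D Q).port l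
        (execList (scaledExtProgram P D Q).recommend m))
      (execList P.recommend (fun n => m (2 * n))) (execList Q.recommend (fun n => m (4 * n + 1)))
      (fun i => l (Sum.inl i)) (fun j => l (Sum.inr j))
      (Q.toAlgorithm.recommend (fun n => m (4 * n + 1))) ?_ ?_ (fun _ => rfl) ?_
    · rw [ha]
      exact this
    · intro n
      by_cases hn : ∃ i, P.port i = n
      · obtain ⟨i, rfl⟩ := hn
        rw [P.port.injective.extend_apply]
        exact (scaledExtProgram P D Q).port.injective.extend_apply l _ (Sum.inl i)
      · rw [Function.extend_apply' _ _ _ hn, Function.extend_apply', ← r1]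
        rintro ⟨i | j, h⟩
        · change 2 * P.port i = 2 * n at h
          exact hn ⟨i, by omega⟩
        · change 8 * Q.port j + 7 = 2 * n at h
          omega
    · intro n
      rw [Function.extend_apply', ← r2]
      rintro ⟨i | j, h⟩
      · change 2 * P.port i = 4 * n + 1 at h
        omega
      · change 8 * Q.port j + 7 = 4 * n + 1 at h
        omega
    · intro j
      exact (scaledExtProgram P D Q).port.injective.extend_apply l _ (Sum.inr j)

end OnlineAlgorithm

/-! ## Polytopes that are filled in block by block -/

/-- A root coordinate and a partition of the other coordinates into blocks. Every block
`b = (b.1, b.2)` of coordinates `b.1` comes with a set `b.2` of coordinates of smaller rank,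
whose sum is to be distributed over `b.1`. -/
structure BlockSystem (P : Type) where
  root : P
  blocks : Set (Finset P × Finset P)
  rank : P → ℕ
  nonempty : ∀ b ∈ blocks, b.1.Nonempty
  exists_block : ∀ p, p ≠ root → ∃ b ∈ blocks, p ∈ b.1
  root_notMem : ∀ b ∈ blocks, root ∉ b.1
  eq_of_mem : ∀ b ∈ blocks, ∀ b' ∈ blocks, ∀ p, p ∈ b.1 → p ∈ b'.1 → b = b'
  rank_lt : ∀ b ∈ blocks, ∀ p ∈ b.1, ∀ q ∈ b.2, rank q < rank p

namespace BlockSystem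

/-- The sum of the coordinates of `x` that are named by elements of `E`. -/
noncomputable def sumOver {P α : Type} [Fintype α] (f : α → P) (E : Finset P) (x : α → ℝ) : ℝ :=
  open Classical in ∑ i, if f i ∈ E then x i else 0

theorem sumOver_sumElim {P α β : Type} [Fintype α] [Fintype β] (f : α → P) (g : β → P)
    (E : Finset P) (z : α ⊕ β → ℝ) : sumOver (Sum.elim f g) E z =
      sumOver f E (fun i => z (Sum.inl i)) + sumOver g E fun j => z (Sum.inr j) :=
  Fintype.sum_sum_type _

theorem sumOver_eq_zero {P α : Type} [Fintype α] {f : α → P} {E : Finset P}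
    (h : ∀ i, f i ∉ E) (x : α → ℝ) : sumOver f E x = 0 := by
  simp [sumOver, h]

theorem sumOver_eq_sum {P α : Type} [Fintype α] {f : α → P} {E : Finset P}
    (h : ∀ i, f i ∈ E) (x : α → ℝ) : sumOver f E x = ∑ i, x i := by
  simp [sumOver, h]

theorem sumOver_nonneg {P α : Type} [Fintype α] (f : α → P) (E : Finset P) {x : α → ℝ}
    (h : ∀ i, 0 ≤ x i) : 0 ≤ sumOver f E x := by
  refine Finset.sum_nonneg fun i _ => ?_
  split_ifs
  exacts [h i, le_rfl]

theorem sumOver_of_bijective {P α : Type} [Fintype α] {f : α → P} (hf : Function.Bijective f)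
    (E : Finset P) (y : P → ℝ) : sumOver f E (fun i => y (f i)) = ∑ p ∈ E, y p := by
  classical
  have := Fintype.ofBijective f hf
  refine (hf.sum_comp fun p => if p ∈ E then y p else 0).trans ?_
  simp

/-- The polytope of a block system, restricted to the coordinates in the image of `f`. -/
def polytopeOn {P α : Type} [Fintype α] (S : BlockSystem P) (f : α → P) : Set (α → ℝ) :=
  {x | (∀ i, 0 ≤ x i) ∧ (∀ i, f i = S.root → x i = 1) ∧
    ∀ b ∈ S.blocks, (∀ p ∈ b.1, ∃ i, f i = p) → sumOver f b.1 x = sumOver f b.2 x}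

/-- The polytope of a block system: nonnegative vectors with root coordinate `1` for which the
sum over the first part of each block is the sum over its second part. -/
def polytope {P : Type} (S : BlockSystem P) : Set (P → ℝ) :=
  {x | (∀ p, 0 ≤ x p) ∧ x S.root = 1 ∧ ∀ b ∈ S.blocks, ∑ p ∈ b.1, x p = ∑ p ∈ b.2, x p}

/-- The coordinates that occur in the second part of the block of `p`. -/
noncomputable def sources {P : Type} [Fintype P] (S : BlockSystem P) (p : P) : Finset P :=
  open Classical in Finset.univ.filter fun q => ∃ b ∈ S.blocks, p ∈ b.1 ∧ q ∈ b.2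

theorem mem_sources {P : Type} [Fintype P] {S : BlockSystem P} {p q : P} :
    q ∈ S.sources p ↔ ∃ b ∈ S.blocks, p ∈ b.1 ∧ q ∈ b.2 := by
  simp [sources]

theorem sources_eq {P : Type} [Fintype P] (S : BlockSystem P) {b : Finset P × Finset P}
    (hb : b ∈ S.blocks) {p : P} (hp : p ∈ b.1) : S.sources p = b.2 := by
  ext q
  rw [mem_sources]
  constructor
  · rintro ⟨b', hb', hp', hq⟩
    rwa [S.eq_of_mem b hb b' hb' p hp hp']
  · exact fun hq => ⟨b, hb, hp, hq⟩

/-- A circuit for the coordinates in the image of an injective map `f`: this image contains the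
root, and with a point of a block the whole block and its second part. -/
structure PartialCircuit {P : Type} [Fintype P] (S : BlockSystem P)
    (R : (s : ℕ) → OnlineAlgorithm (Fin s)) (c : ℕ) {α : Type} [Fintype α] (f : α → P)
    (A : OnlineAlgorithm α) : Prop where
  injective : Function.Injective f
  root_mem : ∃ i, f i = S.root
  closed : ∀ b ∈ S.blocks, ∀ i, f i ∈ b.1 → ∀ p, p ∈ b.1 ∨ p ∈ b.2 → ∃ j, f j = p
  circuit : ScaledExtensionCircuit R (S.polytopeOn f) A
  runsInTime : A.RunsInTime (∑ i, (c + 2 * (S.sources (f i)).card))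

theorem partialCircuit_root {P : Type} [Fintype P] (S : BlockSystem P)
    (R : (s : ℕ) → OnlineAlgorithm (Fin s)) {c : ℕ} (hc : 1 ≤ c) :
    S.PartialCircuit R c (fun _ : Unit => S.root) OnlineAlgorithm.alwaysOne where
  injective := fun _ _ _ => rfl
  root_mem := ⟨(), rfl⟩
  closed b hb _ h := absurd h (S.root_notMem b hb)
  circuit := by
    have h : S.polytopeOn (fun _ : Unit => S.root) = {(fun _ => 1 : Unit → ℝ)} := by
      ext x
      simp only [polytopeOn, Set.mem_ofPred_eq, Set.mem_singleton_iff]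
      constructor
      · rintro ⟨-, h, -⟩
        exact funext fun i => h i trivial
      · rintro rfl
        refine ⟨fun _ => zero_le_one, fun _ _ => rfl, fun b hb h => ?_⟩
        obtain ⟨p, hp⟩ := S.nonempty b hb
        obtain ⟨_, rfl⟩ := h p hp
        exact absurd hp (S.root_notMem b hb)
    rw [h]
    exact ScaledExtensionCircuit.base
  runsInTime := OnlineAlgorithm.runsInTime_alwaysOne.mono (by
    simp only [Finset.univ_unique, Finset.sum_singleton]
    omega)

-- The equation of the new block says that its nonnegative coordinates add up to `h(x)`, which
-- describes a simplex scaled by `h(x)`. By closedness, the blocks already present involve no new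
-- coordinate.
open Classical in
theorem polytopeOn_sumElim {P α β : Type} [Fintype α] [Fintype β]
    (S : BlockSystem P) {b : Finset P × Finset P} (hb : b ∈ S.blocks) {f : α → P} {g : β → P}
    (hf : ∀ b ∈ S.blocks, ∀ i, f i ∈ b.1 → ∀ p, p ∈ b.1 ∨ p ∈ b.2 → ∃ j, f j = p)
    (hfb : ∀ i, f i ∉ b.1) (hgb : ∀ p, p ∈ b.1 ↔ ∃ j, g j = p)
    (hs : ∀ p ∈ b.2, ∃ i, f i = p) :
    S.polytopeOn (Sum.elim f g) = scaledExtension (S.polytopeOn f)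
      (fun x => ∑ i, (if f i ∈ b.2 then 1 else 0) * x i) (stdSimplex ℝ β) := by
  have hg1 : ∀ j, g j ∈ b.1 := fun j => (hgb _).2 ⟨j, rfl⟩
  have hg2 : ∀ j, g j ∉ b.2 := fun j hj => (hs _ hj).elim fun i hi => hfb i (hi ▸ hg1 j)
  have hother : ∀ b' ∈ S.blocks, (∀ p ∈ b'.1, ∃ i, f i = p) →
      ∀ j, g j ∉ b'.1 ∧ g j ∉ b'.2 := by
    intro b' hb' h j
    have key : ¬ ∃ i, f i = g j := fun ⟨i, hi⟩ => hfb i (hi ▸ hg1 j)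
    refine ⟨fun hj => key (h _ hj), fun hj => key ?_⟩
    obtain ⟨p, hp⟩ := S.nonempty b' hb'
    obtain ⟨i, rfl⟩ := h p hp
    exact hf b' hb' i hp _ (Or.inr hj)
  have : Nonempty β := by
    obtain ⟨p, hp⟩ := S.nonempty b hb
    obtain ⟨j, -⟩ := (hgb p).1 hp
    exact ⟨j⟩
  have hc : ∀ x : α → ℝ, ∑ i, (if f i ∈ b.2 then 1 else 0) * x i = sumOver f b.2 x := by
    simp [sumOver]
  simp only [hc]
  ext z
  simp only [scaledExtension, polytopeOn, Set.mem_ofPred_eq, Sum.forall, Sum.elim_inl,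
    Sum.elim_inr, Sum.exists, sumOver_sumElim]
  constructor
  · rintro ⟨⟨z1, z2⟩, ⟨z3, -⟩, z4⟩
    refine ⟨fun i => z (Sum.inl i), ⟨z1, z3, fun b' hb' h => ?_⟩, ?_⟩
    · have h1 := z4 b' hb' fun p hp => Or.inl (h p hp)
      rwa [sumOver_eq_zero (f := g) fun j => (hother b' hb' h j).1,
        sumOver_eq_zero (f := g) fun j => (hother b' hb' h j).2, add_zero, add_zero] at h1
    · have h1 := z4 b hb fun p hp => Or.inr ((hgb p).1 hp)
      rw [sumOver_eq_zero hfb, sumOver_eq_sum hg1, sumOver_eq_zero hg2, add_zero, zero_add] at h1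
      generalize sumOver f b.2 (fun i => z (Sum.inl i)) = c at h1 ⊢
      -- If the scale is `0`, all new coordinates vanish and any point of the simplex represents
      -- them. Otherwise they are divided by the scale.
      by_cases h0 : c = 0
      · rw [h0, Finset.sum_eq_zero_iff_of_nonneg fun j _ => z2 j] at h1
        refine ⟨Pi.single (Classical.arbitrary β) 1, single_mem_stdSimplex ℝ _, ?_⟩
        funext k
        rcases k with i | j
        · rfl
        · simp [h0, h1 j]
      · refine ⟨fun j => z (Sum.inr j) / c, ⟨fun j => div_nonneg (z2 j) ?_, ?_⟩, ?_⟩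
        · exact h1 ▸ Finset.sum_nonneg fun j _ => z2 j
        · rw [← Finset.sum_div, h1, div_self h0]
        · funext k
          rcases k with i | j
          · rfl
          · simp [mul_div_cancel₀ _ h0]
  · rintro ⟨x, ⟨x1, x2, x3⟩, y, ⟨y1, y2⟩, rfl⟩
    simp only [Sum.elim_inl, Sum.elim_inr, Pi.smul_apply, smul_eq_mul]
    refine ⟨⟨x1, fun j => mul_nonneg (sumOver_nonneg f _ x1) (y1 j)⟩,
      ⟨x2, fun j hj => absurd (hj ▸ hg1 j) (S.root_notMem b hb)⟩, fun b' hb' h => ?_⟩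
    obtain ⟨p, hp⟩ := S.nonempty b' hb'
    rcases h p hp with ⟨i, rfl⟩ | ⟨j, rfl⟩
    · have h' : ∀ p ∈ b'.1, ∃ i, f i = p := fun p hp' => hf b' hb' i hp p (Or.inl hp')
      rw [sumOver_eq_zero (f := g) fun j => (hother b' hb' h' j).1,
        sumOver_eq_zero (f := g) fun j => (hother b' hb' h' j).2, add_zero, add_zero, x3 b' hb' h']
    · obtain rfl := S.eq_of_mem b hb b' hb' _ (hg1 j) hp
      rw [sumOver_eq_zero hfb, sumOver_eq_sum hg1, sumOver_eq_zero hg2, add_zero, zero_add,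
        ← Finset.mul_sum, y2, mul_one]

/-- The next block is that of a missing coordinate of least rank: everything its values are computed
from is already present. -/
theorem PartialCircuit.exists_extension {P : Type} [Fintype P] {S : BlockSystem P}
    {R : (s : ℕ) → OnlineAlgorithm (Fin s)} {c k : ℕ}
    (hR : ∀ s, 1 ≤ s → (R s).RunsInTime (k * s)) (hc : k + 6 ≤ c)
    {α : Type} [Fintype α] {f : α → P} {A : OnlineAlgorithm α} (h : S.PartialCircuit R c f A)
    {p : P} (hp : ∀ i, f i ≠ p) :
    ∃ (s : ℕ) (g : Fin s → P) (A' : OnlineAlgorithm (α ⊕ Fin s)),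
      1 ≤ s ∧ S.PartialCircuit R c (Sum.elim f g) A' := by
  classical
  obtain ⟨p, hp, hmin⟩ : ∃ p, (∀ i, f i ≠ p) ∧ ∀ q, S.rank q < S.rank p → ∃ i, f i = q := by
    obtain ⟨p, hp, hmin⟩ := WellFounded.has_min (measure S.rank).wf {p | ∀ i, f i ≠ p} ⟨p, hp⟩
    refine ⟨p, hp, fun q hq => ?_⟩
    by_contra! hne
    exact hmin q hne hq
  obtain ⟨b, hb, hpb⟩ := S.exists_block p fun e => h.root_mem.elim fun i hi => hp i (hi.trans e.symm)
  -- The present coordinates are closed under whole blocks, so a block with one missing coordinate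
  -- is missing entirely.
  have hfb : ∀ i, f i ∉ b.1 := fun i hi =>
    (h.closed b hb i hi p (Or.inl hpb)).elim fun j hj => hp j hj
  have hs : ∀ q ∈ b.2, ∃ i, f i = q := fun q hq => hmin q (S.rank_lt b hb p hpb q hq)
  let g : Fin b.1.card → P := fun j => (b.1.equivFin.symm j : P)
  have hg : Function.Injective g := Subtype.val_injective.comp b.1.equivFin.symm.injective
  have hg1 : ∀ j, g j ∈ b.1 := fun j => (b.1.equivFin.symm j).2
  have hgb : ∀ q, q ∈ b.1 ↔ ∃ j, g j = q := by
    refine fun q => ⟨fun hq => ⟨b.1.equivFin ⟨q, hq⟩, by simp [g]⟩, ?_⟩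
    rintro ⟨j, rfl⟩
    exact hg1 j
  have hcard : 1 ≤ b.1.card := Finset.card_pos.2 ⟨p, hpb⟩
  let a : α → ℝ := fun i => if f i ∈ b.2 then 1 else 0
  refine ⟨b.1.card, g, A.scaledExt a (R b.1.card), hcard, ?_⟩
  refine
    { injective := ?_
      root_mem := ?_
      closed := ?_
      circuit := ?_
      runsInTime := ?_ }
  · exact Function.Injective.sumElim h.injective hg fun i j e => hfb i (e ▸ hg1 j)
  · obtain ⟨i, hi⟩ := h.root_mem
    exact ⟨Sum.inl i, hi⟩
  · rintro b' hb' (i | j) hi q hq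
    · obtain ⟨i', hi'⟩ := h.closed b' hb' i hi q hq
      exact ⟨Sum.inl i', hi'⟩
    · obtain rfl := S.eq_of_mem b hb b' hb' _ (hg1 j) hi
      rcases hq with hq | hq
      · obtain ⟨j', hj'⟩ := (hgb q).1 hq
        exact ⟨Sum.inr j', hj'⟩
      · obtain ⟨i', hi'⟩ := hs q hq
        exact ⟨Sum.inl i', hi'⟩
  · rw [S.polytopeOn_sumElim hb h.closed hfb hgb hs]
    refine ScaledExtensionCircuit.simplex a b.1.card h.circuit (fun x hx => ?_) hcard
    refine Finset.sum_nonneg fun i _ => mul_nonneg ?_ (hx.1 i)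
    simp only [a]
    split_ifs <;> norm_num
  · have h1 := h.runsInTime.scaledExt (hR _ hcard) a (Finset.univ.filter fun i => f i ∈ b.2)
      (fun i hi => by simpa [a] using hi) (fun i hi => by simpa [a] using hi)
    refine h1.mono ?_
    have h2 : (Finset.univ.filter fun i => f i ∈ b.2).card ≤ b.2.card :=
      Finset.card_le_card_of_injOn f (fun i hi => by simpa using hi) h.injective.injOn
    have h3 : ∀ j, c + 2 * (S.sources (g j)).card = c + 2 * b.2.card := fun j => by
      rw [S.sources_eq hb (hg1 j)]
    rw [Fintype.sum_sum_type]
    simp only [Sum.elim_inl, Sum.elim_inr, h3, Finset.sum_const, Finset.card_univ,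
      Fintype.card_fin, smul_eq_mul]
    -- The circuit adds `4 s + 2 ≤ 6 s` steps, which with `k s` for the local device are charged to
    -- the `s ≥ 1` new coordinates. The cost of summing over `b.2` is covered by the share of a
    -- single one of them.
    have h4 : b.1.card * (k + 6 + 2 * b.2.card) ≤ b.1.card * (c + 2 * b.2.card) :=
      Nat.mul_le_mul_left _ (by omega)
    have h5 : b.2.card ≤ b.1.card * b.2.card := Nat.le_mul_of_pos_left _ hcard
    have h6 : b.1.card * (k + 6 + 2 * b.2.card) =
        k * b.1.card + 6 * b.1.card + 2 * (b.1.card * b.2.card) := by ring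
    omega

/-- Every extension adds `s ≥ 1` coordinates, so the number of missing ones decreases until none is
left. -/
theorem PartialCircuit.exists_surjective {P : Type} [Fintype P] {S : BlockSystem P}
    {R : (s : ℕ) → OnlineAlgorithm (Fin s)} {c k : ℕ}
    (hR : ∀ s, 1 ≤ s → (R s).RunsInTime (k * s)) (hc : k + 6 ≤ c)
    {α : Type} [Fintype α] {f : α → P} {A : OnlineAlgorithm α} (h : S.PartialCircuit R c f A) :
    ∃ (β : Type) (_ : Fintype β) (g : β → P) (A' : OnlineAlgorithm β),
      S.PartialCircuit R c g A' ∧ Function.Surjective g := by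
  induction hn : Fintype.card P - Fintype.card α using Nat.strong_induction_on
    generalizing α with
  | _ n ih =>
    by_cases hf : Function.Surjective f
    · exact ⟨α, _, f, A, h, hf⟩
    · simp only [Function.Surjective, not_forall, not_exists] at hf
      obtain ⟨p, hp⟩ := hf
      obtain ⟨s, g, A', hs, h'⟩ := h.exists_extension hR hc hp
      have h1 := Fintype.card_le_of_injective _ h'.injective
      rw [Fintype.card_sum, Fintype.card_fin] at h1
      refine ih _ ?_ h' rfl
      rw [Fintype.card_sum, Fintype.card_fin]
      omega

/-- The polytope of a block system is a chain of scaled extensions with simplices, and its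
regret circuit needs a number of steps linear in the total size of the blocks. -/
theorem exists_circuit {P ι : Type} [Fintype P] [Fintype ι] (S : BlockSystem P) (e : P ≃ ι)
    {R : (s : ℕ) → OnlineAlgorithm (Fin s)} {c k : ℕ}
    (hR : ∀ s, 1 ≤ s → (R s).RunsInTime (k * s)) (hc : k + 6 ≤ c) :
    ∃ A : OnlineAlgorithm ι,
      ScaledExtensionCircuit R {x | (fun p => x (e p)) ∈ S.polytope} A ∧
      A.RunsInTime (c * Fintype.card P + 2 * ∑ p, (S.sources p).card) := by
  classical
  obtain ⟨β, _, g, A, h, hg⟩ :=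
    (S.partialCircuit_root R (show 1 ≤ c by omega)).exists_surjective hR hc
  let u : β ≃ P := Equiv.ofBijective g ⟨h.injective, hg⟩
  refine ⟨A.reindex (u.trans e), ?_, ?_⟩
  · have hX : {x : ι → ℝ | (fun p => x (e p)) ∈ S.polytope} =
        {x : ι → ℝ | (fun i => x (u.trans e i)) ∈ S.polytopeOn g} := by
      ext x
      have hsum : ∀ E : Finset P, sumOver g E (fun i => x (e (g i))) = ∑ p ∈ E, x (e p) :=
        fun E => sumOver_of_bijective ⟨h.injective, hg⟩ E fun p => x (e p)
      simp only [polytope, polytopeOn, Set.mem_ofPred_eq]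
      change _ ↔ (∀ i, 0 ≤ x (e (g i))) ∧ (∀ i, g i = S.root → x (e (g i)) = 1) ∧
        ∀ b ∈ S.blocks, (∀ p ∈ b.1, ∃ i, g i = p) →
          sumOver g b.1 (fun i => x (e (g i))) = sumOver g b.2 (fun i => x (e (g i)))
      simp only [hsum]
      refine and_congr ?_ (and_congr ?_ ?_)
      · exact hg.forall (p := fun p => 0 ≤ x (e p))
      · refine ⟨fun h i hi => hi ▸ h, fun h => ?_⟩
        obtain ⟨i, hi⟩ := hg S.root
        exact hi ▸ h i hi
      · exact ⟨fun h b hb _ => h b hb, fun h b hb => h b hb fun p _ => hg p⟩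
    rw [hX]
    exact h.circuit.rename _
  · refine (h.runsInTime.reindex _).mono (le_of_eq ?_)
    rw [Function.Bijective.sum_comp ⟨h.injective, hg⟩ fun p => c + 2 * (S.sources p).card,
      Finset.sum_add_distrib,
      Finset.mul_sum]
    simp [mul_comm]

end BlockSystem

/-! ## Paths in game trees without chance moves -/

section Paths

variable {Info : Fin 2 → Type} {Act : (i : Fin 2) → Info i → Type}

theorem movesOf_nil (i : Fin 2) : movesOf (Info := Info) (Act := Act) i [] = [] :=
  rfl

theorem movesOf_cons_self {i : Fin 2} (I : Info i) (a : Act i I) (h : List (Move Info Act)) :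
    movesOf i (⟨i, I, a⟩ :: h) = ⟨I, a⟩ :: movesOf i h := by
  simp [movesOf]

theorem movesOf_cons_of_ne {i j : Fin 2} (hij : i ≠ j) (I : Info i) (a : Act i I)
    (h : List (Move Info Act)) : movesOf j (⟨i, I, a⟩ :: h) = movesOf j h := by
  simp [movesOf, hij]

theorem movesOf_append (i : Fin 2) (h h' : List (Move Info Act)) :
    movesOf i (h ++ h') = movesOf i h ++ movesOf i h' :=
  List.filterMap_append

theorem movesOf_mono (i : Fin 2) {h h' : List (Move Info Act)} (hh : h <+: h') :
    movesOf i h <+: movesOf i h' := by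
  obtain ⟨k, rfl⟩ := hh
  rw [movesOf_append]
  exact List.prefix_append _ _

theorem length_movesOf_add {i j : Fin 2} (hij : i ≠ j) (h : List (Move Info Act)) :
    (movesOf i h).length + (movesOf j h).length = h.length := by
  induction h with
  | nil => rfl
  | cons m h ih =>
    obtain ⟨k, I, a⟩ := m
    by_cases hk : k = i
    · subst hk
      rw [movesOf_cons_self, movesOf_cons_of_ne hij, List.length_cons, List.length_cons, ← ih]
      omega
    · obtain rfl : k = j := by omega
      rw [movesOf_cons_self, movesOf_cons_of_ne hk, List.length_cons, List.length_cons, ← ih]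
      omega

/-- A move of Player `i` splits the path on which it is taken. -/
theorem exists_eq_append_of_movesOf_eq {i : Fin 2} {h : List (Move Info Act)}
    {l l' : List (Σ I : Info i, Act i I)} {x : Σ I : Info i, Act i I}
    (e : movesOf i h = l ++ x :: l') :
    ∃ w w', h = w ++ ⟨i, x⟩ :: w' ∧ movesOf i w = l ∧ movesOf i w' = l' := by
  induction h generalizing l with
  | nil => simp [movesOf] at e
  | cons m h ih =>
    obtain ⟨k, I, a⟩ := m
    by_cases hk : k = i
    · subst hk
      rw [movesOf_cons_self] at e
      rcases l with _ | ⟨y, l⟩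
      · obtain ⟨rfl, rfl⟩ := List.cons.inj e
        exact ⟨[], h, rfl, rfl, rfl⟩
      · obtain ⟨rfl, e'⟩ := List.cons.inj e
        obtain ⟨w, w', rfl, rfl, rfl⟩ := ih e'
        exact ⟨⟨k, I, a⟩ :: w, w', rfl, movesOf_cons_self _ _ _, rfl⟩
    · rw [movesOf_cons_of_ne hk] at e
      obtain ⟨w, w', rfl, rfl, rfl⟩ := ih e
      exact ⟨⟨k, I, a⟩ :: w, w', rfl, movesOf_cons_of_ne hk _ _ _, rfl⟩

theorem Reaches.nodeIn_of_append {t t' : GameTree Info Act} {w w' : List (Move Info Act)}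
    {i : Fin 2} {x : Σ I : Info i, Act i I} (r : Reaches t (w ++ ⟨i, x⟩ :: w') t') :
    NodeIn t w x.1 := by
  induction w generalizing t with
  | nil =>
    obtain ⟨I, a⟩ := x
    cases r with
    | cons r => exact ⟨_, Reaches.nil _⟩
  | cons m w ih =>
    cases r with
    | cons r =>
      obtain ⟨next, r'⟩ := ih r
      exact ⟨next, Reaches.cons r'⟩

theorem Reaches.snoc {t : GameTree Info Act} {w : List (Move Info Act)} {i : Fin 2} {I : Info i}
    {next : Act i I → GameTree Info Act} (r : Reaches t w (GameTree.node i I next))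
    (a : Act i I) : Reaches t (w ++ [⟨i, I, a⟩]) (next a) := by
  generalize ht : GameTree.node i I next = t' at r
  induction r with
  | nil t =>
    subst ht
    exact Reaches.cons (Reaches.nil _)
  | cons r ih => exact Reaches.cons (ih ht)

theorem Reaches.eq {t t₁ t₂ : GameTree Info Act} {w : List (Move Info Act)}
    (r₁ : Reaches t w t₁) (r₂ : Reaches t w t₂) : t₁ = t₂ := by
  induction r₁ with
  | nil t => cases r₂; rfl
  | cons r ih =>
    cases r₂ with
    | cons r' => exact ih r'

/-- Every player `i` makes the moves on the path `h` if the moves in `p i` are made in order. -/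
def Consistent (h : List (Move Info Act)) (p : ∀ i, List (Σ I : Info i, Act i I)) : Prop :=
  ∀ i, movesOf i h <+: p i

/-- In the absence of chance moves, the moves of both players determine the path. -/
theorem Reaches.prefix_or_prefix {t t₁ t₂ : GameTree Info Act} {h₁ h₂ : List (Move Info Act)}
    {p : ∀ i, List (Σ I : Info i, Act i I)} (r₁ : Reaches t h₁ t₁) (r₂ : Reaches t h₂ t₂)
    (c₁ : Consistent h₁ p) (c₂ : Consistent h₂ p) : h₁ <+: h₂ ∨ h₂ <+: h₁ := by
  induction r₁ generalizing h₂ p with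
  | nil t => exact Or.inl List.nil_prefix
  | @cons i I next a h t r ih =>
    cases r₂ with
    | nil => exact Or.inr List.nil_prefix
    | @cons _ _ _ b h' _ r' =>
      have e₁ := c₁ i
      have e₂ := c₂ i
      rw [movesOf_cons_self] at e₁ e₂
      obtain ⟨l₁, hl₁⟩ := e₁
      obtain ⟨l₂, hl₂⟩ := e₂
      rw [← hl₁, List.cons_append, List.cons_append] at hl₂
      obtain ⟨hab, hl⟩ := List.cons.inj hl₂
      obtain rfl : b = a := by simpa using hab
      -- Both paths start with the first move of the plan of Player `i`. Below this common move they
      -- are consistent with the plans from which it has been deleted.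
      have key : ∀ k l, movesOf i k ++ l = movesOf i h ++ l₁ →
          Consistent (⟨i, I, b⟩ :: k) p →
          Consistent k (Function.update p i (movesOf i h ++ l₁)) := by
        intro k l hk c j
        by_cases hj : i = j
        · subst hj
          rw [Function.update_self]
          exact ⟨l, hk⟩
        · rw [Function.update_of_ne (Ne.symm hj), ← movesOf_cons_of_ne hj I b]
          exact c j
      rcases ih r' (key h l₁ rfl c₁) (key h' l₂ hl c₂) with h1 | h1
      · exact Or.inl ((List.prefix_cons_inj _).2 h1)
      · exact Or.inr ((List.prefix_cons_inj _).2 h1)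

end Paths

/-! ### Precedence of information sets under perfect recall -/

namespace Game

/-- The moves of Player `i` on the way to the information set `I`. -/
noncomputable def own (G : Game) {i : Fin 2} (I : G.Info i) : List (Σ I : G.Info i, G.Act i I) :=
  movesOf i (Classical.choose (G.exists_node i I))

theorem movesOf_eq_own (G : Game) {i : Fin 2} {I : G.Info i} {u : List (Move G.Info G.Act)}
    (hu : NodeIn G.root u I) : movesOf i u = G.own I :=
  G.perfect_recall i I _ _ hu (Classical.choose_spec (G.exists_node i I))

/-- All moves of Player `i` that make up a sequence. -/
noncomputable def hist (G : Game) {i : Fin 2} (σ : G.Seq i) : List (Σ I : G.Info i, G.Act i I) :=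
  σ.elim [] fun x => G.own x.1 ++ [x]

theorem hist_some (G : Game) {i : Fin 2} (x : Σ I : G.Info i, G.Act i I) :
    G.hist (some x) = G.own x.1 ++ [x] :=
  rfl

/-- The last own move `x` on a path to `I` is taken at a node of `x.1`, and by perfect recall the
own moves before it are `G.own x.1`. A parent sequence thus determines the whole record of the
player. -/
theorem hist_parentSeq (G : Game) {i : Fin 2} (I : G.Info i) :
    G.hist (G.parentSeq I) = G.own I := by
  have h := Classical.choose_spec (G.exists_node i I)
  have e : G.parentSeq I = (G.own I).getLast? := rfl
  rcases List.eq_nil_or_concat (G.own I) with h0 | ⟨l, x, hx⟩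
  · rw [e, h0]
    rfl
  · rw [List.concat_eq_append] at hx
    rw [e, hx, List.getLast?_concat, hist_some]
    obtain ⟨next, r⟩ := h
    obtain ⟨w, w', hw, hl, -⟩ := exists_eq_append_of_movesOf_eq (l := l) (l' := []) (x := x) hx
    rw [hw] at r
    rw [← G.movesOf_eq_own r.nodeIn_of_append, hl]

theorem own_eq_own_of_parentSeq_eq (G : Game) {i : Fin 2} {I I' : G.Info i}
    (h : G.parentSeq I = G.parentSeq I') : G.own I = G.own I' := by
  rw [← hist_parentSeq, ← hist_parentSeq, h]

/-- Some node of `I` is on the path to some node of `J`. -/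
def Before (G : Game) {i j : Fin 2} (I : G.Info i) (J : G.Info j) : Prop :=
  ∃ u v, NodeIn G.root u I ∧ NodeIn G.root v J ∧ u <+: v

/-- The path that is played if Player `i` makes the moves on the way to `I`, and Player `j`
those in `q`, ends in `I`. -/
def Stops (G : Game) {i j : Fin 2} (I : G.Info i) (q : List (Σ J : G.Info j, G.Act j J)) : Prop :=
  ∃ u, NodeIn G.root u I ∧ movesOf j u <+: q

theorem Before.stops {G : Game} {i j : Fin 2} {I : G.Info i} {J : G.Info j} (h : G.Before I J) :
    G.Stops I (G.own J) := by
  obtain ⟨u, v, hu, hv, huv⟩ := h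
  exact ⟨u, hu, G.movesOf_eq_own hv ▸ movesOf_mono j huv⟩

theorem Before.of_mem_parentSeq {G : Game} {i j : Fin 2} {I : G.Info i} {J : G.Info j}
    (h : G.Before I J) {x : Σ I : G.Info i, G.Act i I} (hx : x ∈ G.parentSeq I) :
    G.Before x.1 J := by
  obtain ⟨u, v, hu, hv, huv⟩ := h
  obtain ⟨w, hw, hw'⟩ := G.exists_prefix_of_mem_parentSeq hx hu
  exact ⟨w, v, hw', hv, hw.trans huv⟩

theorem Before.of_mem_parentSeq_right {G : Game} {i j : Fin 2} {I : G.Info i} {J : G.Info j}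
    (h : G.Before I J) {y : Σ J : G.Info j, G.Act j J} (hy : y ∈ G.parentSeq J) :
    G.Before I y.1 ∨ G.Before y.1 I := by
  obtain ⟨u, v, hu, hv, huv⟩ := h
  obtain ⟨w, hw, hw'⟩ := G.exists_prefix_of_mem_parentSeq hy hv
  rcases List.prefix_or_prefix_of_prefix huv hw with h | h
  · exact Or.inl ⟨u, w, hu, hw', h⟩
  · exact Or.inr ⟨w, u, hw', hu, h⟩

/-- A path that continues beyond a node of `I` takes a move of Player `i` there, and so has more
moves of this player than `G.own I`. -/
theorem not_prefix_of_nodeIn (G : Game) {i : Fin 2} {I : G.Info i}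
    {u v : List (Move G.Info G.Act)} {t : GameTree G.Info G.Act} (hu : NodeIn G.root u I)
    (hv : Reaches G.root v t) (huv : u <+: v) (hne : u ≠ v) : ¬ movesOf i v <+: G.own I := by
  obtain ⟨next, r⟩ := hu
  obtain ⟨_ | ⟨⟨k, K, a⟩, w⟩, rfl⟩ := huv
  · simp at hne
  · obtain ⟨next', r'⟩ := hv.nodeIn_of_append
    injection r.eq r' with h1 h2 h3
    subst h1
    obtain rfl := eq_of_heq h2
    intro h
    have := h.length_le
    rw [movesOf_append, movesOf_cons_self, List.length_append, List.length_cons,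
      G.movesOf_eq_own ⟨next, r⟩] at this
    omega

theorem nodeIn_unique {G : Game} {i j : Fin 2} {I : G.Info i} {J : G.Info j}
    {u : List (Move G.Info G.Act)} (hI : NodeIn G.root u I) (hJ : NodeIn G.root u J) :
    i = j ∧ HEq I J := by
  obtain ⟨next, r⟩ := hI
  obtain ⟨next', r'⟩ := hJ
  injection r.eq r' with h1 h2 h3
  exact ⟨h1, h2⟩

theorem forall_of_ne {i j : Fin 2} (hij : i ≠ j) {Q : Fin 2 → Prop} (hi : Q i) (hj : Q j)
    (k : Fin 2) : Q k := by
  by_cases h : k = i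
  · exact h ▸ hi
  · obtain rfl : k = j := by omega
    exact hj

theorem eq_of_ne_of_ne {i j k : Fin 2} (hi : i ≠ k) (hj : j ≠ k) : i = j := by
  omega

theorem prefix_or_prefix_of_movesOf (G : Game) {i j : Fin 2} (hij : i ≠ j)
    {u v : List (Move G.Info G.Act)} {t t' : GameTree G.Info G.Act}
    (hu : Reaches G.root u t) (hv : Reaches G.root v t')
    {l : List (Σ I : G.Info i, G.Act i I)} {q : List (Σ J : G.Info j, G.Act j J)}
    (h1 : movesOf i u <+: l) (h2 : movesOf j u <+: q) (h3 : movesOf i v <+: l)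
    (h4 : movesOf j v <+: q) : u <+: v ∨ v <+: u := by
  refine hu.prefix_or_prefix hv
    -- The empty default plan is never used: `i` and `j` are the only two players.
    (p := Function.update (Function.update (fun _ => []) i l) j q) ?_ ?_ <;>
  · refine forall_of_ne hij ?_ ?_
    · rwa [Function.update_of_ne hij, Function.update_self]
    · rwa [Function.update_self]

/-- The same plans are played in both cases, so the two nodes lie on one path. If they were
different, Player `i` would have made a further move before the later one, against the equality of
the records. -/
theorem Stops.eq {G : Game} {i j : Fin 2} (hij : i ≠ j) {I I' : G.Info i}
    {q : List (Σ J : G.Info j, G.Act j J)} (h : G.Stops I q) (h' : G.Stops I' q)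
    (ho : G.own I = G.own I') : I = I' := by
  obtain ⟨u, hu, huq⟩ := h
  obtain ⟨v, hv, hvq⟩ := h'
  have mu := G.movesOf_eq_own hu
  have mv := G.movesOf_eq_own hv
  have huv : u = v := by
    by_contra hne
    obtain ⟨_, ru⟩ := id hu
    obtain ⟨_, rv⟩ := id hv
    rcases G.prefix_or_prefix_of_movesOf hij ru rv (l := G.own I) (by rw [mu]) huq
      (by rw [mv, ho]) hvq with h | h
    · exact G.not_prefix_of_nodeIn hu rv h hne (by rw [mv, ho])
    · exact G.not_prefix_of_nodeIn hv ru h (Ne.symm hne) (by rw [mu, ho])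
  subst huv
  exact eq_of_heq (nodeIn_unique hu hv).2

/-- If both players make the moves that lead to their own set, a single path results, and it cannot
end both at `I` and at `J`. This excludes cycles of precedence between the players. -/
theorem Stops.false {G : Game} {i j : Fin 2} (hij : i ≠ j) {I : G.Info i} {J : G.Info j}
    (h : G.Stops I (G.own J)) (h' : G.Stops J (G.own I)) : False := by
  obtain ⟨u, hu, huq⟩ := h
  obtain ⟨v, hv, hvq⟩ := h'
  have mu := G.movesOf_eq_own hu
  have mv := G.movesOf_eq_own hv
  have hne : u ≠ v := by
    rintro rfl
    exact hij (nodeIn_unique hu hv).1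
  obtain ⟨_, ru⟩ := id hu
  obtain ⟨_, rv⟩ := id hv
  rcases G.prefix_or_prefix_of_movesOf hij ru rv (mu ▸ List.prefix_rfl) huq hvq
    (mv ▸ List.prefix_rfl) with h | h
  · exact G.not_prefix_of_nodeIn hu rv h hne hvq
  · exact G.not_prefix_of_nodeIn hv ru h (Ne.symm hne) huq

theorem Before.asymm {G : Game} {i j : Fin 2} (hij : i ≠ j) {I : G.Info i} {J : G.Info j}
    (h : G.Before I J) : ¬ G.Before J I :=
  fun h' => h.stops.false hij h'.stops

theorem Before.not_of_parentSeq_eq {G : Game} {i j : Fin 2} (hij : i ≠ j) {I : G.Info i}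
    {J J' : G.Info j} (h : G.Before I J) (hJ : G.parentSeq J' = G.parentSeq J) :
    ¬ G.Before J' I :=
  fun h' => Stops.false hij (G.own_eq_own_of_parentSeq_eq hJ ▸ h.stops) h'.stops

theorem Before.eq_of_parentSeq_eq {G : Game} {i j : Fin 2} (hij : i ≠ j) {I I' : G.Info i}
    {J : G.Info j} (h : G.Before I J) (h' : G.Before I' J)
    (hI : G.parentSeq I = G.parentSeq I') : I = I' :=
  Stops.eq hij h.stops h'.stops (G.own_eq_own_of_parentSeq_eq hI)

/-! ### The rank of a pair of sequences -/

/-- The joint number of moves in a pair of sequences. -/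
noncomputable def total (G : Game) (p : ∀ i, G.Seq i) : ℕ :=
  (G.hist (p 0)).length + (G.hist (p 1)).length

theorem total_eq (G : Game) {i j : Fin 2} (hij : i ≠ j) (p : ∀ i, G.Seq i) :
    G.total p = (G.hist (p i)).length + (G.hist (p j)).length := by
  rcases (by omega : (i = 0 ∧ j = 1) ∨ (i = 1 ∧ j = 0)) with ⟨rfl, rfl⟩ | ⟨rfl, rfl⟩
  · rfl
  · exact Nat.add_comm _ _

/-- `h` is a path in the game tree that the players follow if they make the moves in `p`. -/
def Follows (G : Game) (h : List (Move G.Info G.Act)) (p : ∀ i, G.Seq i) : Prop :=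
  (∃ t, Reaches G.root h t) ∧ Consistent h fun i => G.hist (p i)

theorem Follows.of_ne {G : Game} {i j : Fin 2} (hij : i ≠ j) {h : List (Move G.Info G.Act)}
    {p : ∀ i, G.Seq i} {t : GameTree G.Info G.Act} (r : Reaches G.root h t)
    (hi : movesOf i h <+: G.hist (p i)) (hj : movesOf j h <+: G.hist (p j)) : G.Follows h p :=
  ⟨⟨t, r⟩, forall_of_ne hij hi hj⟩

theorem Follows.length_le {G : Game} {h : List (Move G.Info G.Act)} {p : ∀ i, G.Seq i}
    (hh : G.Follows h p) : h.length ≤ G.total p := by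
  rw [← length_movesOf_add (show (0 : Fin 2) ≠ 1 by decide) h]
  exact Nat.add_le_add (hh.2 0).length_le (hh.2 1).length_le

/-- The number of moves that are made if the players make the moves in `p` as long as these
are available. -/
noncomputable def played (G : Game) (p : ∀ i, G.Seq i) : ℕ :=
  sSup {n | ∃ h, G.Follows h p ∧ h.length = n}

theorem bddAbove_played (G : Game) (p : ∀ i, G.Seq i) :
    BddAbove {n | ∃ h, G.Follows h p ∧ h.length = n} :=
  ⟨G.total p, by rintro _ ⟨h, hh, rfl⟩; exact hh.length_le⟩

theorem Follows.length_le_played {G : Game} {h : List (Move G.Info G.Act)} {p : ∀ i, G.Seq i}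
    (hh : G.Follows h p) : h.length ≤ G.played p :=
  le_csSup (G.bddAbove_played p) ⟨h, hh, rfl⟩

theorem exists_follows (G : Game) (p : ∀ i, G.Seq i) :
    ∃ h, G.Follows h p ∧ h.length = G.played p :=
  Nat.sSup_mem (s := {n | ∃ h, G.Follows h p ∧ h.length = n})
    ⟨0, [], ⟨⟨_, Reaches.nil _⟩, fun _ => List.nil_prefix⟩, rfl⟩ (G.bddAbove_played p)

theorem played_le_total (G : Game) (p : ∀ i, G.Seq i) : G.played p ≤ G.total p := by
  obtain ⟨h, hh, e⟩ := G.exists_follows p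
  exact e ▸ hh.length_le

/-- An upper bound for the joint number of moves in a pair of sequences. -/
noncomputable def totalBound (G : Game) : ℕ :=
  open Classical in (Finset.univ : Finset (∀ i, G.Seq i)).sup G.total

theorem total_le_totalBound (G : Game) (p : ∀ i, G.Seq i) : G.total p ≤ G.totalBound := by
  classical
  exact Finset.le_sup (f := G.total) (Finset.mem_univ p)

/-- The rank of a pair of sequences: pairs whose moves can all be made come first, by their
number of moves; then come the other pairs, by decreasing number of moves that can be made, and
then by their number of moves. -/
noncomputable def pairRank (G : Game) (p : ∀ i, G.Seq i) : ℕ :=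
  if G.total p = G.played p then G.played p
  else (G.totalBound + 1) * (G.totalBound - G.played p) + G.total p

/-- Here `p` has one move more than `q`. Either `q` is fully playable and `p` is not or is longer,
or neither is and the same number of moves is played, so that `total` decides. -/
theorem pairRank_lt_of_total (G : Game) {p q : ∀ i, G.Seq i} (h1 : G.total p = G.total q + 1)
    (h2 : G.total q = G.played q ∨ (G.total p ≠ G.played p ∧ G.played q = G.played p)) :
    G.pairRank q < G.pairRank p := by
  have a1 := G.played_le_total p
  have a2 := G.played_le_total q
  have a3 := G.total_le_totalBound p
  unfold pairRank
  by_cases hq : G.total q = G.played q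
  · rw [if_pos hq]
    split_ifs with hp
    · omega
    · omega
  · obtain ⟨hp, e⟩ := h2.resolve_left hq
    rw [if_neg hq, if_neg hp, e]
    omega

/-- The rank codes a lexicographic order: one more played move lowers the product by at least
`totalBound + 1`, which outweighs the additional move in `total`. -/
theorem pairRank_lt_of_played (G : Game) {p q : ∀ i, G.Seq i} (h1 : G.total q = G.total p + 1)
    (h2 : G.total p ≠ G.played p) (h3 : G.played p < G.played q) :
    G.pairRank q < G.pairRank p := by
  have a1 := G.played_le_total p
  have a2 := G.played_le_total q
  have a3 := G.total_le_totalBound q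
  have a4 : (G.totalBound + 1) * (G.totalBound - G.played q + 1) ≤
      (G.totalBound + 1) * (G.totalBound - G.played p) := Nat.mul_le_mul_left _ (by omega)
  rw [mul_add, mul_one] at a4
  unfold pairRank
  rw [if_neg h2]
  split_ifs with hq
  · omega
  · omega

/-- Taking back a move of Player `j` at an information set after which the other player does
not move in `p` decreases the rank. -/
theorem pairRank_lt_of_before (G : Game) {p q : ∀ i, G.Seq i} {i j : Fin 2} (hij : i ≠ j)
    {J : G.Info j} {b : G.Act j J} (hpj : p j = some ⟨J, b⟩) (hqj : q j = G.parentSeq J)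
    (hi : q i = p i) (hb : ∀ x ∈ p i, G.Before x.1 J) : G.pairRank q < G.pairRank p := by
  have hq : G.hist (q j) = G.own J := by rw [hqj, hist_parentSeq]
  have hp : G.hist (p j) = G.own J ++ [⟨J, b⟩] := by rw [hpj, hist_some]
  have ht : G.total p = G.total q + 1 := by
    rw [G.total_eq hij, G.total_eq hij, hq, hp, hi, List.length_append, List.length_singleton]
    omega
  have hmono : ∀ h, G.Follows h q → G.Follows h p := by
    rintro h ⟨⟨t, h1⟩, h2⟩
    refine Follows.of_ne hij h1 ?_ ?_
    · rw [← hi]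
      exact h2 i
    · rw [hp]
      exact (hq ▸ h2 j : movesOf j h <+: G.own J).trans (List.prefix_append _ _)
  have hle : G.played q ≤ G.played p := by
    obtain ⟨h, hh, e⟩ := G.exists_follows q
    exact e ▸ (hmono h hh).length_le_played
  have hqt := G.played_le_total q
  refine G.pairRank_lt_of_total ht ?_
  obtain ⟨h, hh, e⟩ := G.exists_follows p
  have hj := hh.2 j
  simp only [hp] at hj
  -- Either the maximal path of `p` takes the move at `J`, and then all moves of `q` were made
  -- before it, or it never does, and then it is a path for `q` as well.
  rcases List.prefix_concat_iff.1 hj with hj | hj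
  · left
    obtain ⟨v, w, rfl, hv, hw⟩ := exists_eq_append_of_movesOf_eq (l' := []) hj
    obtain ⟨⟨t, r⟩, hc⟩ := hh
    have hvJ : NodeIn G.root v J := r.nodeIn_of_append
    have hvi : movesOf i v = G.hist (p i) := by
      have hc' : movesOf i v <+: G.hist (p i) := (movesOf_mono i (List.prefix_append _ _)).trans (hc i)
      rcases hx : p i with _ | x
      · rw [hx] at hc'
        exact List.prefix_nil.1 hc'
      · rw [hx, hist_some] at hc'
        rcases List.prefix_concat_iff.1 hc' with h | h
        · rw [h, hist_some]
        -- If Player `i` had not yet made the last move `x`, the play would stop at `J` on the way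
        -- to `x.1`, although `x.1` precedes `J`.
        · exact (Stops.false hij (hb x hx).stops ⟨v, hvJ, h⟩).elim
    obtain ⟨_, rv⟩ := hvJ
    have hvq : G.Follows v q := by
      refine Follows.of_ne hij rv ?_ ?_
      · rw [hi, hvi]
      · rw [hq, hv]
    have hl := length_movesOf_add hij v
    rw [hvi, hv] at hl
    refine le_antisymm ?_ hqt
    rw [G.total_eq hij, hq, hi, hl]
    exact hvq.length_le_played
  · right
    have hhq : G.Follows h q := by
      refine Follows.of_ne hij hh.1.choose_spec ?_ ?_
      · rw [hi]
        exact hh.2 i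
      · rw [hq]
        exact hj
    have := hhq.length_le_played
    exact ⟨by omega, by omega⟩

/-- Adding a move of Player `i` at an information set before which the other player does not
stop in `p` decreases the rank. -/
theorem pairRank_lt_of_after (G : Game) {p q : ∀ i, G.Seq i} {i j : Fin 2} (hij : i ≠ j)
    {I : G.Info i} {a : G.Act i I} (hpi : p i = G.parentSeq I) (hqi : q i = some ⟨I, a⟩)
    (hj : q j = p j) {y : Σ J : G.Info j, G.Act j J} (hy : y ∈ p j) (hb : G.Before I y.1) :
    G.pairRank q < G.pairRank p := by
  have hq : G.hist (q i) = G.own I ++ [⟨I, a⟩] := by rw [hqi, hist_some]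
  have hp : G.hist (p i) = G.own I := by rw [hpi, hist_parentSeq]
  have hpj : G.hist (p j) = G.own y.1 ++ [y] := by rw [Option.mem_def.1 hy, hist_some]
  have ht : G.total q = G.total p + 1 := by
    rw [G.total_eq hij, G.total_eq hij, hq, hp, hj, List.length_append, List.length_singleton]
    omega
  obtain ⟨u, hu, huy⟩ := hb.stops
  have mu := G.movesOf_eq_own hu
  obtain ⟨next, ru⟩ := id hu
  have hl := length_movesOf_add hij u
  have hlt : u.length < G.total p := by
    rw [G.total_eq hij, hp, hpj, ← hl, mu, List.length_append, List.length_singleton]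
    have := huy.length_le
    omega
  -- Under `p` the play stops at the node `u` of `I`, as Player `i` has no move there. Under `q` the
  -- move `a` continues it.
  have hle : G.played p ≤ u.length := by
    obtain ⟨h, ⟨⟨t, r⟩, hc⟩, e⟩ := G.exists_follows p
    rw [← e]
    have hci := hc i
    have hcj := hc j
    simp only [hp, hpj] at hci hcj
    rcases G.prefix_or_prefix_of_movesOf hij ru r (mu ▸ List.prefix_rfl)
      (huy.trans (List.prefix_append _ _)) hci hcj with h1 | h1
    · by_cases hne : u = h
      · rw [hne]
      · exact (G.not_prefix_of_nodeIn hu r h1 hne hci).elim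
    · exact h1.length_le
  have huq : G.Follows (u ++ [⟨i, I, a⟩]) q := by
    refine Follows.of_ne hij (ru.snoc a) ?_ ?_
    · rw [hq, movesOf_append, mu, movesOf_cons_self, movesOf_nil]
    · rw [hj, hpj, movesOf_append, movesOf_cons_of_ne hij, movesOf_nil, List.append_nil]
      exact huy.trans (List.prefix_append _ _)
  have hlq := huq.length_le_played
  rw [List.length_append, List.length_singleton] at hlq
  exact G.pairRank_lt_of_played ht (by omega) (by omega)

end Game

namespace Game

/-! ### The blocks of correlation plans -/

/-- Relevance of a pair of sequences that is given as a function of the player. -/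
def RelevantFun (G : Game) (p : ∀ i, G.Seq i) : Prop :=
  ∀ i j, i ≠ j → ∀ x ∈ p i, ∀ y ∈ p j, G.Before x.1 y.1 ∨ G.Before y.1 x.1

/-- The relevant pairs of sequences, as functions of the player. -/
abbrev Pair (G : Game) : Type := {p : ∀ i, G.Seq i // G.RelevantFun p}

/-- The pair `p` can be extended by the actions of Player `j` at `J`. -/
def Extends (G : Game) (p : ∀ i, G.Seq i) {j : Fin 2} (J : G.Info j) : Prop :=
  p j = G.parentSeq J ∧ ∀ i, i ≠ j → ∀ x ∈ p i, G.Before x.1 J ∨ G.Before J x.1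

/-- The pair `p` can be extended at `J`, and `J` precedes the last move of the other player. -/
def ExtendsBackward (G : Game) (p : ∀ i, G.Seq i) {j : Fin 2} (J : G.Info j) : Prop :=
  p j = G.parentSeq J ∧ ∃ i, i ≠ j ∧ ∃ x ∈ p i, G.Before J x.1

/-- The pair `p` can be extended at `J`, after the last move of the other player, and no
continuation of the other player precedes `J`. -/
def ExtendsForward (G : Game) (p : ∀ i, G.Seq i) {j : Fin 2} (J : G.Info j) : Prop :=
  p j = G.parentSeq J ∧ ∀ i, i ≠ j → (∀ x ∈ p i, G.Before x.1 J) ∧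
    ∀ I : G.Info i, p i = G.parentSeq I → ¬ G.Before I J

theorem ExtendsForward.extends {G : Game} {p : ∀ i, G.Seq i} {j : Fin 2} {J : G.Info j}
    (h : G.ExtendsForward p J) : G.Extends p J :=
  ⟨h.1, fun i hij x hx => Or.inl ((h.2 i hij).1 x hx)⟩

theorem ExtendsBackward.extends {G : Game} {p : ∀ i, G.Seq i} {j : Fin 2} {J : G.Info j}
    (h : G.ExtendsBackward p J) : G.Extends p J := by
  obtain ⟨h1, i, hij, x, hx, hb⟩ := h
  refine ⟨h1, fun i' hi' x' hx' => ?_⟩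
  obtain rfl := eq_of_ne_of_ne hij hi'
  obtain rfl := Option.mem_unique hx hx'
  exact Or.inr hb

theorem relevantFun_update {G : Game} {p : ∀ i, G.Seq i} {j : Fin 2}
    {σ : G.Seq j} (h : ∀ y ∈ σ, ∀ i, i ≠ j → ∀ x ∈ p i, G.Before x.1 y.1 ∨ G.Before y.1 x.1) :
    G.RelevantFun (Function.update p j σ) := by
  intro i k hik x hx y hy
  by_cases hij : i = j
  · subst hij
    rw [Function.update_self] at hx
    rw [Function.update_of_ne (Ne.symm hik)] at hy
    exact (h x hx k (Ne.symm hik) y hy).symm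
  · rw [Function.update_of_ne hij] at hx
    by_cases hkj : k = j
    · subst hkj
      rw [Function.update_self] at hy
      exact h y hy i hik x hx
    · exact (hij (by omega)).elim

/-- The extension of `p` by the action `b` at `J`. -/
def extend {G : Game} (p : G.Pair) {j : Fin 2} {J : G.Info j} (h : G.Extends p.1 J)
    (b : G.Act j J) : G.Pair :=
  ⟨Function.update p.1 j (some ⟨J, b⟩), relevantFun_update fun y hy => by
    obtain rfl := Option.some.inj hy
    exact h.2⟩

theorem extend_apply_self {G : Game} (p : G.Pair) {j : Fin 2} {J : G.Info j}
    (h : G.Extends p.1 J) (b : G.Act j J) : (extend p h b).1 j = some ⟨J, b⟩ :=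
  Function.update_self _ _ _

noncomputable instance (G : Game) : Fintype G.Pair := Fintype.ofFinite _

/-- The extensions of `p` by the actions at `J`. -/
noncomputable def extensions (G : Game) (p : G.Pair) {j : Fin 2} (J : G.Info j) :
    Finset G.Pair :=
  open Classical in Finset.univ.filter fun q =>
    ∃ b : G.Act j J, q.1 = Function.update p.1 j (some ⟨J, b⟩)

theorem mem_extensions {G : Game} {p q : G.Pair} {j : Fin 2} {J : G.Info j} :
    q ∈ G.extensions p J ↔ ∃ b : G.Act j J, q.1 = Function.update p.1 j (some ⟨J, b⟩) := by
  simp [extensions]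

theorem sum_extensions {G : Game} {p : G.Pair} {j : Fin 2} {J : G.Info j}
    (h : G.Extends p.1 J) (x : G.Pair → ℝ) :
    ∑ q ∈ G.extensions p J, x q = ∑ b : G.Act j J, x (extend p h b) := by
  classical
  have hinj : Function.Injective (extend p h) := by
    intro b b' e
    have e' := congrFun (congrArg Subtype.val e) j
    simpa [extend] using e'
  have himage : G.extensions p J = Finset.univ.image (extend p h) := by
    ext q
    rw [mem_extensions, Finset.mem_image]
    constructor
    · rintro ⟨b, hb⟩
      exact ⟨b, Finset.mem_univ _, Subtype.ext hb.symm⟩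
    · rintro ⟨b, -, rfl⟩
      exact ⟨b, rfl⟩
  rw [himage, Finset.sum_image hinj.injOn]

theorem extensions_apply {G : Game} {p q : G.Pair} {j : Fin 2} {J : G.Info j}
    (h : q ∈ G.extensions p J) : (∃ b, q.1 j = some ⟨J, b⟩) ∧ ∀ i, i ≠ j → q.1 i = p.1 i := by
  obtain ⟨b, hb⟩ := mem_extensions.1 h
  rw [hb]
  exact ⟨⟨b, Function.update_self _ _ _⟩, fun i hi => Function.update_of_ne hi _ _⟩

theorem eq_of_mem_extensions {G : Game} {p p' q : G.Pair} {j : Fin 2} {J J' : G.Info j}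
    (h : q ∈ G.extensions p J) (h' : q ∈ G.extensions p' J') (hp : p.1 j = G.parentSeq J)
    (hp' : p'.1 j = G.parentSeq J') : p = p' ∧ J = J' := by
  obtain ⟨⟨b, hb⟩, h1⟩ := extensions_apply h
  obtain ⟨⟨b', hb'⟩, h1'⟩ := extensions_apply h'
  rw [hb] at hb'
  obtain rfl : J = J' := congrArg Sigma.fst (Option.some.inj hb')
  refine ⟨Subtype.ext (funext fun i => ?_), rfl⟩
  by_cases hi : i = j
  · subst hi
    rw [hp, hp']
  · rw [← h1 i hi, h1' i hi]

/-- The blocks of pairs that are distributed among the actions at an information set. -/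
def forwardBlocks (G : Game) : Set (Finset G.Pair × Finset G.Pair) :=
  {B | ∃ (p : G.Pair) (j : Fin 2) (J : G.Info j), G.ExtendsForward p.1 J ∧
    B = (G.extensions p J, {p})}

/-- The blocks of single pairs that are obtained as sums over the actions at an information
set. -/
def backwardBlocks (G : Game) : Set (Finset G.Pair × Finset G.Pair) :=
  {B | ∃ (p : G.Pair) (j : Fin 2) (J : G.Info j), G.ExtendsBackward p.1 J ∧
    B = ({p}, G.extensions p J)}

/-- For one player, two sets with the same parent sequence cannot both precede the last set of the
opponent. For different players, the last sets of both would precede each other. -/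
theorem ExtendsBackward.unique {G : Game} {p : ∀ i, G.Seq i} {i i' : Fin 2} {I : G.Info i}
    {I' : G.Info i'} (h : G.ExtendsBackward p I) (h' : G.ExtendsBackward p I') :
    i = i' ∧ HEq I I' := by
  obtain ⟨h1, k, hk, x, hx, hb⟩ := h
  obtain ⟨h1', k', hk', x', hx', hb'⟩ := h'
  by_cases hi : i = i'
  · subst hi
    obtain rfl := eq_of_ne_of_ne hk hk'
    obtain rfl := Option.mem_unique hx hx'
    exact ⟨rfl, heq_of_eq (hb.eq_of_parentSeq_eq (Ne.symm hk) hb' (h1.symm.trans h1'))⟩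
  · obtain rfl : k = i' := by omega
    obtain rfl : k' = i := by omega
    rw [h1] at hx'
    rw [h1'] at hx
    exact ((hb.of_mem_parentSeq hx').asymm hi (hb'.of_mem_parentSeq hx)).elim

/-- If `I` belongs to the player of `J`, then `J` is the parent of `I` and would precede the
opponent's last set, which precedes `J`. If `I` belongs to the opponent, it is a continuation that
precedes `J`, which the last clause of `ExtendsForward` forbids. -/
theorem ExtendsForward.not_extendsBackward {G : Game} {p q : G.Pair} {j i : Fin 2}
    {J : G.Info j} {I : G.Info i} (h : G.ExtendsForward p.1 J) (hq : q ∈ G.extensions p J) :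
    ¬ G.ExtendsBackward q.1 I := by
  rintro ⟨h1, k, hk, x, hx, hb⟩
  obtain ⟨⟨b, hqj⟩, hqi⟩ := extensions_apply hq
  by_cases hi : i = j
  · subst hi
    rw [hqi k hk] at hx
    exact (Before.of_mem_parentSeq hb (h1.symm.trans hqj)).asymm (Ne.symm hk) ((h.2 k hk).1 x hx)
  · obtain rfl : k = j := by omega
    obtain rfl := Option.some.inj (hx.symm.trans hqj)
    rw [hqi i hi] at h1
    exact (h.2 i hi).2 I h1 hb

theorem ExtendsForward.unique {G : Game} {p p' q : G.Pair} {j j' : Fin 2} {J : G.Info j}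
    {J' : G.Info j'} (h : G.ExtendsForward p.1 J) (h' : G.ExtendsForward p'.1 J')
    (hq : q ∈ G.extensions p J) (hq' : q ∈ G.extensions p' J') :
    p = p' ∧ j = j' ∧ HEq J J' := by
  by_cases hj : j = j'
  · subst hj
    obtain ⟨rfl, rfl⟩ := eq_of_mem_extensions hq hq' h.1 h'.1
    exact ⟨rfl, rfl, HEq.rfl⟩
  · obtain ⟨⟨b, hb⟩, h1⟩ := extensions_apply hq
    obtain ⟨⟨b', hb'⟩, h1'⟩ := extensions_apply hq'
    rw [h1 j' (Ne.symm hj)] at hb'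
    rw [h1' j hj] at hb
    exact (((h.2 j' (Ne.symm hj)).1 _ hb').asymm (Ne.symm hj) ((h'.2 j hj).1 _ hb)).elim

/-- The later of the two last moves is taken back. The only obstruction to a forward block is a
continuation of the opponent that precedes this move, and there the pair extends backward. -/
theorem exists_forward_or_backward (G : Game) (p : G.Pair) (hp : p.1 ≠ fun _ => none) :
    (∃ (i : Fin 2) (I : G.Info i), G.ExtendsBackward p.1 I) ∨
      ∃ (q : G.Pair) (j : Fin 2) (J : G.Info j),
        G.ExtendsForward q.1 J ∧ p ∈ G.extensions q J := by
  by_cases hback : ∃ (i : Fin 2) (I : G.Info i), G.ExtendsBackward p.1 I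
  · exact Or.inl hback
  · right
    obtain ⟨j, y, hy, hlast⟩ : ∃ (j : Fin 2) (y : Σ J : G.Info j, G.Act j J), y ∈ p.1 j ∧
        ∀ i, i ≠ j → ∀ x ∈ p.1 i, G.Before x.1 y.1 := by
      obtain ⟨i, hi⟩ : ∃ i, p.1 i ≠ none := by
        by_contra! h
        exact hp (funext h)
      obtain ⟨x, hx⟩ := Option.ne_none_iff_exists'.1 hi
      by_cases hx' : ∀ k, k ≠ i → ∀ z ∈ p.1 k, G.Before z.1 x.1
      · exact ⟨i, x, hx, hx'⟩
      · push Not at hx'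
        obtain ⟨k, hk, z, hz, hn⟩ := hx'
        refine ⟨k, z, hz, fun i' hi' x' hx' => ?_⟩
        obtain rfl := eq_of_ne_of_ne (Ne.symm hk) hi'
        obtain rfl := Option.some.inj (hx.symm.trans hx')
        exact (p.2 k i hk z hz x hx).resolve_left hn
    have hrel : G.RelevantFun (Function.update p.1 j (G.parentSeq y.1)) := by
      refine relevantFun_update fun z hz i hi x hx => ?_
      exact (hlast i hi x hx).of_mem_parentSeq_right hz
    refine ⟨⟨_, hrel⟩, j, y.1, ⟨Function.update_self _ _ _, fun i hi => ?_⟩, ?_⟩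
    · simp only [Function.update_of_ne hi]
      exact ⟨hlast i hi, fun I hI hb => hback ⟨i, I, hI, j, Ne.symm hi, y, hy, hb⟩⟩
    · refine mem_extensions.2 ⟨y.2, ?_⟩
      simp only [Function.update_idem]
      rw [eq_comm, Function.update_eq_self_iff]
      exact hy.symm

theorem pairRank_lt_of_forward {G : Game} {p q : G.Pair} {j : Fin 2} {J : G.Info j}
    (h : G.ExtendsForward p.1 J) (hq : q ∈ G.extensions p J) :
    G.pairRank p.1 < G.pairRank q.1 := by
  obtain ⟨⟨b, hb⟩, h1⟩ := extensions_apply hq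
  obtain ⟨i, hij⟩ : ∃ i : Fin 2, i ≠ j := exists_ne j
  refine G.pairRank_lt_of_before hij hb h.1 (h1 i hij).symm ?_
  rw [h1 i hij]
  exact (h.2 i hij).1

theorem pairRank_lt_of_backward {G : Game} {p q : G.Pair} {i : Fin 2} {I : G.Info i}
    (h : G.ExtendsBackward p.1 I) (hq : q ∈ G.extensions p I) :
    G.pairRank q.1 < G.pairRank p.1 := by
  obtain ⟨⟨a, ha⟩, h1⟩ := extensions_apply hq
  obtain ⟨h2, k, hk, y, hy, hb⟩ := h
  exact G.pairRank_lt_of_after (Ne.symm hk) h2 ha (h1 k hk) hy hb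

/-- The block system of correlation plans. -/
noncomputable def blockSystem (G : Game) : BlockSystem G.Pair where
  root := ⟨fun _ => none, fun i j _ x hx => by simp at hx⟩
  blocks := G.forwardBlocks ∪ G.backwardBlocks
  rank p := G.pairRank p.1
  nonempty := by
    rintro b (⟨p, j, J, h, rfl⟩ | ⟨p, j, J, h, rfl⟩)
    · obtain ⟨b⟩ := G.nonemptyAct j J
      exact ⟨extend p h.extends b, mem_extensions.2 ⟨b, rfl⟩⟩
    · exact ⟨p, Finset.mem_singleton_self p⟩
  exists_block := by
    intro p hp
    rcases G.exists_forward_or_backward p (fun e => hp (Subtype.ext e)) with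
      ⟨i, I, h⟩ | ⟨q, j, J, h, hq⟩
    · exact ⟨_, Or.inr ⟨p, i, I, h, rfl⟩, Finset.mem_singleton_self p⟩
    · exact ⟨_, Or.inl ⟨q, j, J, h, rfl⟩, hq⟩
  root_notMem := by
    rintro b (⟨p, j, J, h, rfl⟩ | ⟨p, j, J, ⟨-, i, -, x, hx, -⟩, rfl⟩) hr
    · obtain ⟨⟨b, hb⟩, -⟩ := extensions_apply hr
      cases hb
    · obtain rfl := Finset.mem_singleton.1 hr
      cases hx
  eq_of_mem := by
    rintro b (⟨p, j, J, h, rfl⟩ | ⟨p, j, J, h, rfl⟩) b'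
      (⟨p', j', J', h', rfl⟩ | ⟨p', j', J', h', rfl⟩) q hq hq'
    · obtain ⟨rfl, rfl, hJ⟩ := h.unique h' hq hq'
      obtain rfl := eq_of_heq hJ
      rfl
    · obtain rfl := Finset.mem_singleton.1 hq'
      exact (h.not_extendsBackward hq h').elim
    · obtain rfl := Finset.mem_singleton.1 hq
      exact (h'.not_extendsBackward hq' h).elim
    · obtain rfl := Finset.mem_singleton.1 hq
      obtain rfl := Finset.mem_singleton.1 hq'
      obtain ⟨rfl, hJ⟩ := h.unique h'
      obtain rfl := eq_of_heq hJ
      rfl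
  rank_lt := by
    rintro b (⟨p, j, J, h, rfl⟩ | ⟨p, j, J, h, rfl⟩) q hq q' hq'
    · obtain rfl := Finset.mem_singleton.1 hq'
      exact pairRank_lt_of_forward h hq
    · obtain rfl := Finset.mem_singleton.1 hq
      exact pairRank_lt_of_backward h hq'

/-- Two sums over sets of different players would make each of these sets precede the other. For one
player, the pair `q` determines the set and thereby its parent sequence. -/
theorem backward_eq_of_mem_extensions {G : Game} {p p' q : G.Pair} {i i' : Fin 2} {I : G.Info i}
    {I' : G.Info i'} (h : G.ExtendsBackward p.1 I) (h' : G.ExtendsBackward p'.1 I')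
    (hq : q ∈ G.extensions p I) (hq' : q ∈ G.extensions p' I') : p = p' := by
  by_cases hi : i = i'
  · subst hi
    exact (eq_of_mem_extensions hq hq' h.1 h'.1).1
  · exfalso
    obtain ⟨⟨b, hb⟩, h1⟩ := extensions_apply hq
    obtain ⟨⟨b', hb'⟩, h1'⟩ := extensions_apply hq'
    obtain ⟨-, k, hk, x, hx, hbx⟩ := h
    obtain ⟨-, k', hk', x', hx', hbx'⟩ := h'
    obtain rfl : k = i' := by omega
    obtain rfl : k' = i := by omega
    rw [h1 k hk] at hb'
    rw [h1' k' hk'] at hb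
    obtain rfl := Option.some.inj (hx.symm.trans hb')
    obtain rfl := Option.some.inj (hx'.symm.trans hb)
    exact hbx.asymm hi hbx'

/-- A pair in a forward block has a single source. For the backward blocks, the incidences are
counted from the side of the sources, each of which occurs at most once. -/
theorem sum_card_sources_le (G : Game) :
    ∑ p, (G.blockSystem.sources p).card ≤ 2 * Fintype.card G.Pair := by
  classical
  let r : G.Pair → G.Pair → Prop := fun p q =>
    ∃ (i : Fin 2) (I : G.Info i), G.ExtendsBackward p.1 I ∧ q ∈ G.extensions p I
  have h1 : ∀ p, (G.blockSystem.sources p).card ≤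
      1 + (Finset.bipartiteAbove r Finset.univ p).card := by
    intro p
    by_cases hp : p = G.blockSystem.root
    · have : G.blockSystem.sources p = ∅ := by
        refine Finset.eq_empty_of_forall_notMem fun q hq => ?_
        obtain ⟨b, hb, hpb, -⟩ := BlockSystem.mem_sources.1 hq
        exact G.blockSystem.root_notMem b hb (hp ▸ hpb)
      rw [this, Finset.card_empty]
      exact Nat.zero_le _
    · obtain ⟨b, hb, hpb⟩ := G.blockSystem.exists_block p hp
      rw [G.blockSystem.sources_eq hb hpb]
      rcases hb with ⟨q, j, J, h, rfl⟩ | ⟨q, j, J, h, rfl⟩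
      · simp
      · obtain rfl := Finset.mem_singleton.1 hpb
        refine le_trans (Finset.card_le_card fun q hq => ?_) (Nat.le_add_left _ 1)
        rw [Finset.mem_bipartiteAbove]
        exact ⟨Finset.mem_univ _, j, J, h, hq⟩
  have h2 : ∀ q, (Finset.bipartiteBelow r Finset.univ q).card ≤ 1 := by
    intro q
    refine Finset.card_le_one.2 fun p hp p' hp' => ?_
    rw [Finset.mem_bipartiteBelow] at hp hp'
    obtain ⟨-, i, I, h, hq⟩ := hp
    obtain ⟨-, i', I', h', hq'⟩ := hp'
    exact backward_eq_of_mem_extensions h h' hq hq'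
  calc ∑ p, (G.blockSystem.sources p).card
      ≤ ∑ p : G.Pair, (1 + (Finset.bipartiteAbove r Finset.univ p).card) :=
        Finset.sum_le_sum fun p _ => h1 p
    _ = Fintype.card G.Pair + ∑ q : G.Pair, (Finset.bipartiteBelow r Finset.univ q).card := by
        rw [Finset.sum_add_distrib, Finset.sum_card_bipartiteAbove_eq_sum_card_bipartiteBelow]
        simp
    _ ≤ Fintype.card G.Pair + ∑ q : G.Pair, 1 :=
        Nat.add_le_add_left (Finset.sum_le_sum fun q _ => h2 q) _
    _ = 2 * Fintype.card G.Pair := by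
        simp
        omega

/-! ### Correlation plans form the polytope of the block system -/

theorem sum_extensions_of_mem_polytope {G : Game} {x : G.Pair → ℝ}
    (hx : x ∈ G.blockSystem.polytope) {p : G.Pair} {j : Fin 2} {J : G.Info j}
    (h : G.ExtendsForward p.1 J ∨ G.ExtendsBackward p.1 J) :
    ∑ q ∈ G.extensions p J, x q = x p := by
  rcases h with h | h
  · simpa using hx.2.2 _ (Or.inl ⟨p, j, J, h, rfl⟩)
  · simpa using (hx.2.2 _ (Or.inr ⟨p, j, J, h, rfl⟩)).symm

/-- The two orders in which a pair can be extended at information sets `I`, `J` of both players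
lead to the same pairs. -/
theorem extend_extend_comm {G : Game} {p : G.Pair} {i j : Fin 2} (hij : i ≠ j) {I : G.Info i}
    {J : G.Info j} (hI : G.Extends p.1 I) (hJ : G.Extends p.1 J) (a : G.Act i I) (b : G.Act j J)
    (hI' : G.Extends (extend p hJ b).1 I) (hJ' : G.Extends (extend p hI a).1 J) :
    extend (extend p hJ b) hI' a = extend (extend p hI a) hJ' b :=
  Subtype.ext (Function.update_comm (Ne.symm hij) _ _ _)

/-- If the equation at `J` belongs to no block, some continuation `I` of the opponent precedes `J`.
Every extension of `p` at `J` is then a backward sum over `I`. After the sums are exchanged, the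
equation at `J` for the extensions of `p` at `I` has smaller rank, and the remaining sum over `I`
belongs to a block. -/
theorem sum_extend_of_mem_polytope {G : Game} {x : G.Pair → ℝ}
    (hx : x ∈ G.blockSystem.polytope) (p : G.Pair) {j : Fin 2} {J : G.Info j}
    (h : G.Extends p.1 J) : ∑ b : G.Act j J, x (extend p h b) = x p := by
  -- The fixed action `b₀` only serves to measure the induction: the rank that decreases is that of
  -- the extension by `b₀`.
  obtain ⟨b₀⟩ := G.nonemptyAct j J
  induction hn : G.pairRank (extend p h b₀).1 using Nat.strong_induction_on generalizing p with
  | _ n ih =>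
  subst hn
  by_cases hfb : G.ExtendsForward p.1 J ∨ G.ExtendsBackward p.1 J
  · rw [← sum_extensions h, sum_extensions_of_mem_polytope hx hfb]
  rw [not_or] at hfb
  obtain ⟨hf, hb⟩ := hfb
  obtain ⟨i, hij⟩ : ∃ i : Fin 2, i ≠ j := exists_ne j
  have hfirst : ∀ y ∈ p.1 i, G.Before y.1 J := fun y hy =>
    (h.2 i hij y hy).resolve_right fun hn => hb ⟨h.1, i, hij, y, hy, hn⟩
  obtain ⟨I, hpI, hIJ⟩ : ∃ I : G.Info i, p.1 i = G.parentSeq I ∧ G.Before I J := by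
    by_contra! hne
    refine hf ⟨h.1, fun k hk => ?_⟩
    obtain rfl := eq_of_ne_of_ne hij hk
    exact ⟨hfirst, hne⟩
  -- No set with the parent sequence of `J` can precede `I`, because `I` precedes `J`. So `I` can
  -- only fail to be forward if it precedes the last move of Player `j`.
  have hI : G.ExtendsForward p.1 I ∨ G.ExtendsBackward p.1 I := by
    by_cases hback : G.ExtendsBackward p.1 I
    · exact Or.inr hback
    · refine Or.inl ⟨hpI, fun k hk => ?_⟩
      obtain rfl := eq_of_ne_of_ne (Ne.symm hij) hk
      refine ⟨fun y hy => ?_, fun J' hJ' => hIJ.not_of_parentSeq_eq hij (hJ'.symm.trans h.1)⟩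
      exact (hIJ.of_mem_parentSeq_right (h.1 ▸ hy)).resolve_left
        fun hn => hback ⟨hpI, j, Ne.symm hij, y, hy, hn⟩
  have hIe : G.Extends p.1 I := hI.elim ExtendsForward.extends ExtendsBackward.extends
  have hI' : ∀ b, G.ExtendsBackward (extend p h b).1 I := fun b =>
    ⟨(Function.update_of_ne hij _ _).trans hpI, j, Ne.symm hij, ⟨J, b⟩,
      extend_apply_self p h b, hIJ⟩
  have hJ' : ∀ a, G.Extends (extend p hIe a).1 J := fun a => by
    refine ⟨(Function.update_of_ne (Ne.symm hij) _ _).trans h.1, fun k hk y hy => ?_⟩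
    obtain rfl := eq_of_ne_of_ne hij hk
    obtain rfl := Option.some.inj ((extend_apply_self p hIe a).symm.trans hy)
    exact Or.inl hIJ
  calc ∑ b, x (extend p h b)
      = ∑ b, ∑ a, x (extend (extend p h b) (hI' b).extends a) := by
        refine Finset.sum_congr rfl fun b _ => ?_
        rw [← sum_extensions, sum_extensions_of_mem_polytope hx (Or.inr (hI' b))]
    _ = ∑ a, ∑ b, x (extend (extend p hIe a) (hJ' a) b) := by
        rw [Finset.sum_comm]
        refine Finset.sum_congr rfl fun a _ => Finset.sum_congr rfl fun b _ => ?_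
        rw [extend_extend_comm hij hIe h a b (hI' b).extends (hJ' a)]
    _ = ∑ a, x (extend p hIe a) := by
        refine Finset.sum_congr rfl fun a _ => ih _ ?_ _ (hJ' a) rfl
        rw [← extend_extend_comm hij hIe h a b₀ (hI' b₀).extends (hJ' a)]
        exact pairRank_lt_of_backward (hI' b₀) (mem_extensions.2 ⟨a, rfl⟩)
    _ = x p := by rw [← sum_extensions, sum_extensions_of_mem_polytope hx hI]

theorem mem_polytope_blockSystem {G : Game} {x : G.Pair → ℝ} :
    x ∈ G.blockSystem.polytope ↔ (∀ p, 0 ≤ x p) ∧ x G.blockSystem.root = 1 ∧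
      ∀ (p : G.Pair) (j : Fin 2) (J : G.Info j) (h : G.Extends p.1 J),
        ∑ b : G.Act j J, x (extend p h b) = x p := by
  constructor
  · exact fun hx => ⟨hx.1, hx.2.1, fun p j J h => sum_extend_of_mem_polytope hx p h⟩
  · rintro ⟨h1, h2, h3⟩
    refine ⟨h1, h2, ?_⟩
    rintro b (⟨p, j, J, h, rfl⟩ | ⟨p, j, J, h, rfl⟩)
    · rw [Finset.sum_singleton, sum_extensions h.extends, h3]
    · rw [Finset.sum_singleton, sum_extensions h.extends, h3]

/-- The pair of sequences of both players as a function of the player. -/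
def toFun {G : Game} (σ₁ : G.Seq 0) (σ₂ : G.Seq 1) : ∀ i, G.Seq i
  | 0 => σ₁
  | 1 => σ₂

theorem connected_iff {G : Game} {I : G.Info 0} {J : G.Info 1} :
    G.Connected I J ↔ G.Before I J ∨ G.Before J I := by
  constructor
  · rintro ⟨u, v, hu, hv, h | h⟩
    exacts [Or.inl ⟨u, v, hu, hv, h⟩, Or.inr ⟨v, u, hv, hu, h⟩]
  · rintro (⟨u, v, hu, hv, h⟩ | ⟨u, v, hu, hv, h⟩)
    exacts [⟨u, v, hu, hv, Or.inl h⟩, ⟨v, u, hv, hu, Or.inr h⟩]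

theorem relevantFun_iff {G : Game} {p : ∀ i, G.Seq i} :
    G.RelevantFun p ↔ G.Relevant (p 0) (p 1) := by
  constructor
  · exact fun h x hx y hy => connected_iff.2 (h 0 1 (by decide) x hx y hy)
  · intro h i j hij x hx y hy
    rcases (by omega : (i = 0 ∧ j = 1) ∨ (i = 1 ∧ j = 0)) with ⟨rfl, rfl⟩ | ⟨rfl, rfl⟩
    · exact connected_iff.1 (h x hx y hy)
    · exact (connected_iff.1 (h y hy x hx)).symm

/-- Relevant pairs of sequences as functions of the player. -/
def pairEquiv (G : Game) : G.Pair ≃ G.RelevantPair where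
  toFun p := ⟨(p.1 0, p.1 1), relevantFun_iff.1 p.2⟩
  invFun p := ⟨toFun p.1.1 p.1.2, relevantFun_iff.2 p.2⟩
  left_inv _ := Subtype.ext (funext (Fin.forall_fin_two.2 ⟨rfl, rfl⟩))
  right_inv _ := rfl

/-- The two families of equations of Ξ are the cases `j = 0` and `j = 1` of the equations in
`mem_polytope_blockSystem`. -/
theorem Xi_eq (G : Game) :
    G.Xi = {ξ | (fun p => ξ (G.pairEquiv p)) ∈ G.blockSystem.polytope} := by
  ext ξ
  simp only [Xi, Set.mem_ofPred_eq, mem_polytope_blockSystem]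
  refine and_congr G.pairEquiv.forall_congr_right.symm (and_congr Iff.rfl ?_)
  have key0 : ∀ (p : G.Pair) (I : G.Info 0) (h : G.Extends p.1 I) (h' : G.RelevantInfoSeq I (p.1 1)),
      (∑ a : G.Act 0 I, ξ (G.pairEquiv (extend p h a)) = ξ (G.pairEquiv p)) ↔
        ∑ a : G.Act 0 I, ξ ⟨(some ⟨I, a⟩, p.1 1), h'.child a⟩ =
          ξ ⟨(G.parentSeq I, p.1 1), h'.parent⟩ := by
    intro p I h h'
    have e : G.pairEquiv p = ⟨(G.parentSeq I, p.1 1), h'.parent⟩ :=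
      Subtype.ext (Prod.ext h.1 rfl)
    rw [e]
    exact Iff.rfl
  have key1 : ∀ (p : G.Pair) (J : G.Info 1) (h : G.Extends p.1 J) (h' : G.RelevantSeqInfo (p.1 0) J),
      (∑ b : G.Act 1 J, ξ (G.pairEquiv (extend p h b)) = ξ (G.pairEquiv p)) ↔
        ∑ b : G.Act 1 J, ξ ⟨(p.1 0, some ⟨J, b⟩), h'.child b⟩ =
          ξ ⟨(p.1 0, G.parentSeq J), h'.parent⟩ := by
    intro p J h h'
    have e : G.pairEquiv p = ⟨(p.1 0, G.parentSeq J), h'.parent⟩ :=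
      Subtype.ext (Prod.ext rfl h.1)
    rw [e]
    exact Iff.rfl
  constructor
  · rintro ⟨h0, h1⟩ p j J h
    rcases (by omega : j = 0 ∨ j = 1) with rfl | rfl
    · have h' : G.RelevantInfoSeq J (p.1 1) := fun y hy =>
        connected_iff.2 (h.2 1 (by decide) y hy).symm
      exact (key0 p J h h').2 (h0 J _ h')
    · have h' : G.RelevantSeqInfo (p.1 0) J := fun x hx =>
        connected_iff.2 (h.2 0 (by decide) x hx)
      exact (key1 p J h h').2 (h1 J _ h')
  · intro h
    constructor
    · intro I σ₂ hr
      have he : G.Extends (toFun (G.parentSeq I) σ₂) I := by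
        refine ⟨rfl, fun i hi x hx => ?_⟩
        obtain rfl : i = 1 := by omega
        exact (connected_iff.1 (hr x hx)).symm
      exact (key0 ⟨toFun (G.parentSeq I) σ₂, relevantFun_iff.2 hr.parent⟩ I he hr).1
        (h _ _ _ he)
    · intro J σ₁ hr
      have he : G.Extends (toFun σ₁ (G.parentSeq J)) J := by
        refine ⟨rfl, fun i hi x hx => ?_⟩
        obtain rfl : i = 0 := by omega
        exact connected_iff.1 (hr x hx)
      exact (key1 ⟨toFun σ₁ (G.parentSeq J), relevantFun_iff.2 hr.parent⟩ J he hr).1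
        (h _ _ _ he)

end Game

theorem mainTheorem2 :
    ∃ (R : (s : ℕ) → OnlineAlgorithm (Fin s)) (C : ℕ),
      (∀ s : ℕ, 1 ≤ s →
        (R s).IsRegretMinimizer (stdSimplex ℝ (Fin s)) ∧
        (R s).HannanConsistent (stdSimplex ℝ (Fin s)) ∧
        (R s).RunsInTime (C * s)) ∧
      ∀ G : Game, ∃ A : OnlineAlgorithm G.RelevantPair,
        A.IsRegretMinimizer G.Xi ∧
        A.HannanConsistent G.Xi ∧
        A.RunsInTime (C * Fintype.card G.RelevantPair) ∧
        ScaledExtensionCircuit R G.Xi A := by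
  have hR : ∀ s : ℕ, 1 ≤ s → (OnlineAlgorithm.regretMatching s).RunsInTime (15 * s) :=
    fun s hs => (OnlineAlgorithm.runsInTime_regretMatching s).mono (by omega)
  have hR' : ∀ s : ℕ, 1 ≤ s →
      (OnlineAlgorithm.regretMatching s).IsRegretMinimizer (stdSimplex ℝ (Fin s)) ∧
      (OnlineAlgorithm.regretMatching s).HannanConsistent (stdSimplex ℝ (Fin s)) :=
    fun s hs => ⟨OnlineAlgorithm.isRegretMinimizer_regretMatching hs,
      OnlineAlgorithm.hannanConsistent_regretMatching hs⟩
  -- The constant is `25 = (15 + 6) + 2 * 2`: `15 + 6` steps per coordinate, and two steps for each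
  -- of at most two sources per coordinate on average.
  refine ⟨OnlineAlgorithm.regretMatching, 25, fun s hs => ⟨(hR' s hs).1, (hR' s hs).2,
    (hR s hs).mono (by omega)⟩, fun G => ?_⟩
  obtain ⟨A, hA, hT⟩ := G.blockSystem.exists_circuit G.pairEquiv hR (le_refl (15 + 6))
  rw [← G.Xi_eq] at hA
  obtain ⟨-, -, h1, h2⟩ := hA.isRegretMinimizer_and_hannanConsistent hR'
  refine ⟨A, h1, h2, hT.mono ?_, hA⟩
  have := G.sum_card_sources_le
  rw [← Fintype.card_congr G.pairEquiv]
  omega
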